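/- Let $q$ be a positive, continuously differentiable probability density on $\mathbb R^n$ (with respect to Lebesgue measure), let $L^2$ be the space of square integrable functions for the distribution $Q$ with density $q$, with inner product $\langle\cdot,\cdot\rangle$, and let $\Sigma$ be a continuously differentiable function on $\mathbb R^n$ whose values are symmetric positive definite $n\times n$ matrices. Let $\mathcal D(f)$ be the set of all $\phi\in L^2$ for which there is a measurable $g:\mathbb R^n\to\mathbb R^n$ with $\int g'\Sigma g\,q\,dx<\infty$ and $\int\phi\,\nabla\psi\,dx=-\int g\,\psi\,dx$ for every compactly supported $C^1$ function $\psi$; such a $g$ is unique up to null sets and is denoted $\nabla\phi$. For $\phi,\psi\in\mathcal D(f)$ put $$f(\phi,\psi)=\tfrac12\int(\nabla\phi)'\,\Sigma\,(\nabla\psi)\,q\,dx .$$ Write $q^{1/2}=e^{-h}$ and assume that $h$ is twice continuously differentiable. Suppose that there are a twice continuously differentiable function $v$ on $\mathbb R^n$ and a constant $\underline c>0$ such that, with $\varsigma=e^{v}$, $$\Sigma(x)\ \ge\ \varsigma(x)^2 I\ \ge\ \underline c\, I\qquad\text{for all }x\in\mathbb R^n$$ in the order of symmetric matrices, and that (a)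 $\nabla h(x)\neq0$ for all $x$ outside some compact set, and $\displaystyle\lim_{|x|\to\infty}\frac{|\nabla v(x)|}{|\nabla h(x)|}=0$; (b) $\displaystyle\lim_{|x|\to\infty}\varsigma(x)^2\left(-\operatorname{tr}\nabla^2h(x)+|\nabla h(x)|^2\right)=+\infty$. Then for every $\theta>0$ the set $$\{\phi\in\mathcal D(f): f(\phi,\phi)+\theta\langle\phi,\phi\rangle\le1\}$$ is precompact (has compact closure) in $L^2$. -/

import Mathlib

open MeasureTheory Filter Topology
open scoped MatrixOrder

noncomputable section

namespace NPC

/-- The state space `ℝⁿ` with the Euclidean norm. -/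
abbrev E (n : ℕ) : Type := EuclideanSpace ℝ (Fin n)

/-- The population distribution `Q`, with density `q` with respect to Lebesgue measure. -/
def popMeasure {n : ℕ} (q : E n → ℝ) : Measure (E n) :=
  volume.withDensity fun x => ENNReal.ofReal (q x)

/-- The space `L²` of the population distribution. -/
abbrev L2 {n : ℕ} (q : E n → ℝ) : Type := Lp ℝ 2 (popMeasure q)

/-- The bilinear expression `u' A w`. -/
def quad {n : ℕ} (A : Matrix (Fin n) (Fin n) ℝ) (u w : E n) : ℝ :=
  u.ofLp ⬝ᵥ (A.mulVec w.ofLp)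

/-- `g` is a weak derivative of `φ`, as required of the elements of the form domain: it is
measurable, `∫ g' S g q` is finite, and `∫ φ ∇ψ = - ∫ g ψ` (Lebesgue integrals) for every
compactly supported `C¹` function `ψ`. -/
structure IsWeakGradient {n : ℕ} (q : E n → ℝ) (S : E n → Matrix (Fin n) (Fin n) ℝ)
    (φ : E n → ℝ) (g : E n → E n) : Prop where
  measurable : Measurable g
  finite_energy : Integrable (fun x => quad (S x) (g x) (g x)) (popMeasure q)
  integral_eq : ∀ ψ : E n → ℝ, ContDiff ℝ 1 ψ → HasCompactSupport ψ →
    ∫ x, φ x • gradient ψ x = - ∫ x, ψ x • g x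

/-- The domain of the form: all `φ ∈ L²` that have a weak derivative of finite energy. -/
def formDomain {n : ℕ} (q : E n → ℝ) (S : E n → Matrix (Fin n) (Fin n) ℝ) : Set (L2 q) :=
  {φ | ∃ g, IsWeakGradient q S φ g}

open Classical in
/-- The weak derivative `∇φ` of an element of the form domain. It is determined up to a null
set; outside the domain the value is `0` and is not used. -/
def weakGrad {n : ℕ} (q : E n → ℝ) (S : E n → Matrix (Fin n) (Fin n) ℝ) (φ : L2 q) :
    E n → E n :=
  if hφ : ∃ g, IsWeakGradient q S φ g then hφ.choose else 0

/-- The quadratic form `f(φ, ψ) = ½ ∫ (∇φ)' S (∇ψ) q`. -/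
def form {n : ℕ} (q : E n → ℝ) (S : E n → Matrix (Fin n) (Fin n) ℝ) (φ ψ : L2 q) : ℝ :=
  (1 / 2) * ∫ x, quad (S x) (weakGrad q S φ x) (weakGrad q S ψ x) ∂(popMeasure q)

/-- The constraint set `{φ ∈ D(f) : f(φ, φ) + θ ⟨φ, φ⟩ ≤ 1}`. -/
def constraintSet {n : ℕ} (q : E n → ℝ) (S : E n → Matrix (Fin n) (Fin n) ℝ) (θ : ℝ) :
    Set (L2 q) :=
  {φ | φ ∈ formDomain q S ∧ form q S φ φ + θ * inner ℝ φ φ ≤ 1}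

/-- The compactness condition: the constraint set has compact closure in `L²`
(for one `θ > 0` or, equivalently, for all; the form with all `θ > 0` is used). -/
def CompactnessCondition {n : ℕ} (q : E n → ℝ) (S : E n → Matrix (Fin n) (Fin n) ℝ) : Prop :=
  ∀ θ : ℝ, 0 < θ → IsCompact (closure (constraintSet q S θ))

/-- The matrix of second partial derivatives of `h`. -/
def hessian {n : ℕ} (h : E n → ℝ) (x : E n) : Matrix (Fin n) (Fin n) ℝ :=
  Matrix.of fun i j =>
    iteratedFDeriv ℝ 2 h x ![EuclideanSpace.single i 1, EuclideanSpace.single j 1]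

end NPC

end

/-! On the constraint set `∫ φ² q ≤ 1/θ` and `∫ ς² |∇φ|² q ≤ 2`. Precompactness then needs two
facts: tails `∫_{|x|>R} φ² q` that are uniformly small for large `R`, and compactness on each ball.

Tails. Expand `|∇φ - φ ∇h / 2|² ≥ 0` against a compactly supported weight `ω` and integrate `2 φ ∇φ
= ∇(φ²)` by parts; this bounds `∫ ω |∇φ|²` below by a weighted integral of `φ²`
(`LocalSobolev.hardy`). With `ω` a cutoff of `ς² q`, the resulting potential is `½ ς² (-Δh + (3/2)
|∇h|² - 2 ∇v·∇h)`. The field `∇h / 2`, unlike `∇h`, leaves a spare `½ |∇h|²`, which absorbs the `∇v`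
term by (a); the potential then tends to infinity by (b), and bounded energy forces small tails
(`exists_tail_le`).

The cutoff is a nonincreasing function of `h`, so its derivative enters with a favourable sign and
needs no bound on `∇h`. It has compact support because `h → ∞`: by (b), `Δq = q (4 |∇h|² - 2 Δh) ≥
0` near infinity, and a nonnegative integrable function that is subharmonic there tends to zero
(`tendsto_zero_of_lap_nonneg`).

Balls. On bounded sets `q` and `ς² q` are bounded below, so cut-off elements are bounded in Lebesgue
`L²` and move by `O(|z|)` under translation by `z`. Averaging over small balls brings them close to
a bounded set of step functions in one finite-dimensional space (`exists_step_approx`). -/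

noncomputable section

namespace NPC

/-! ### Weak derivatives and the translation group on `L²` -/

section Translation

variable {V : Type*} [NormedAddCommGroup V] [InnerProductSpace ℝ V] [FiniteDimensional ℝ V]
  [MeasurableSpace V] [BorelSpace V]

/-- `g` is a weak derivative of `φ` in the direction `e`. -/
def HasWeakDeriv (e : V) (φ g : V → ℝ) : Prop :=
  ∀ ψ : V → ℝ, ContDiff ℝ 1 ψ → HasCompactSupport ψ →
    ∫ x, φ x * fderiv ℝ ψ x e = - ∫ x, g x * ψ x

/-- Translation by `z` as a linear isometry of `L²`. -/
def translate (z : V) :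
    Lp ℝ 2 (volume : Measure V) →ₗᵢ[ℝ] Lp ℝ 2 (volume : Measure V) :=
  Lp.compMeasurePreservingₗᵢ ℝ (fun x => x + z) (measurePreserving_add_right volume z)

lemma coeFn_translate (z : V) (f : Lp ℝ 2 (volume : Measure V)) :
    translate z f =ᵐ[volume] fun x => f (x + z) :=
  Lp.coeFn_compMeasurePreserving f (measurePreserving_add_right volume z)

lemma continuous_translate (e : V) (f : Lp ℝ 2 (volume : Measure V)) :
    Continuous fun t : ℝ => translate (t • e) f := by
  let G : C(ℝ, C(V, V)) := ContinuousMap.curry ⟨fun p : ℝ × V => p.2 + p.1 • e, by fun_prop⟩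
  exact Continuous.compMeasurePreservingLp (f := fun _ => f) (g := G) continuous_const
    G.continuous (fun t => measurePreserving_add_right volume (t • e)) (by simp)

lemma translate_zero (f : Lp ℝ 2 (volume : Measure V)) : translate 0 f = f := by
  apply Lp.ext
  filter_upwards [coeFn_translate 0 f] with x hx
  simpa using hx

lemma inner_translate (z : V) (f ψ : Lp ℝ 2 (volume : Measure V)) (ψ' : V → ℝ)
    (hψ : ψ =ᵐ[volume] ψ') :
    inner ℝ (translate z f) ψ = ∫ x, f x * ψ' (x - z) := by
  rw [L2.inner_def, ← integral_add_right_eq_self (fun x => f x * ψ' (x - z)) z]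
  apply integral_congr_ae
  filter_upwards [coeFn_translate z f, hψ] with x hx hx'
  simp [hx, hx', mul_comm]

/-- The integral is the convolution of `f` with the reflection of `ψ`, evaluated at `t • e`, so the
derivative falls on the smooth factor. -/
lemma hasDerivAt_integral_mul_comp_sub_smul {f ψ : V → ℝ} (hf : LocallyIntegrable f)
    (hψ : ContDiff ℝ 1 ψ) (hc : HasCompactSupport ψ) (e : V) (t : ℝ) :
    HasDerivAt (fun t : ℝ => ∫ x, f x * ψ (x - t • e))
      (- ∫ x, f x * fderiv ℝ ψ (x - t • e) e) t := by
  have hc' : HasCompactSupport fun y => ψ (-y) := hc.comp_homeomorph (Homeomorph.neg V)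
  have hψ' : ContDiff ℝ 1 fun y => ψ (-y) := hψ.comp contDiff_neg
  have h := (hc'.hasFDerivAt_convolution_right (ContinuousLinearMap.mul ℝ ℝ) hf hψ'
    (t • e)).comp_hasDerivAt t ((hasDerivAt_id t).smul_const e)
  have hd : Continuous fun x => fderiv ℝ (fun y => ψ (-y)) x := hψ'.continuous_fderiv one_ne_zero
  convert! h using 1
  · ext s
    simp [convolution]
  · rw [one_smul, convolution_precompR_apply _ hf (hc'.fderiv ℝ) hd, ← integral_neg]
    simp only [convolution, ContinuousLinearMap.mul_apply']
    apply integral_congr_ae (ae_of_all _ fun x => ?_)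
    have : HasFDerivAt (fun y => ψ (-y)) (-(fderiv ℝ ψ (x - t • e))) (t • e - x) := by
      have h1 : HasFDerivAt ψ (fderiv ℝ ψ (x - t • e)) (-(t • e - x)) := by
        rw [neg_sub]; exact ((hψ.differentiable one_ne_zero) _).hasFDerivAt
      have := h1.comp (t • e - x) (hasFDerivAt_id (𝕜 := ℝ) (t • e - x)).neg
      convert! this using 1
      ext; simp
    simp [this.fderiv]

variable {e : V} {f g : Lp ℝ 2 (volume : Measure V)}

lemma locallyIntegrable_coeFn (f : Lp ℝ 2 (volume : Measure V)) :
    LocallyIntegrable (f : V → ℝ) :=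
  (Lp.memLp f).locallyIntegrable (by norm_num)

lemma HasWeakDeriv.hasDerivAt_inner_translate (h : HasWeakDeriv e f g)
    {ψ : Lp ℝ 2 (volume : Measure V)} {ψ' : V → ℝ} (hψ : ψ =ᵐ[volume] ψ')
    (hd : ContDiff ℝ 1 ψ') (hc : HasCompactSupport ψ') (t : ℝ) :
    HasDerivAt (fun t : ℝ => inner ℝ (translate (t • e) f) ψ)
      (inner ℝ (translate (t • e) g) ψ) t := by
  simp only [inner_translate _ _ _ _ hψ]
  have h1 := hasDerivAt_integral_mul_comp_sub_smul (locallyIntegrable_coeFn f) hd hc e t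
  have h2 := h (fun x => ψ' (x - t • e)) (hd.comp (contDiff_id.sub contDiff_const))
    (hc.comp_homeomorph (Homeomorph.subRight (t • e)))
  simp only [fderiv_comp_sub] at h2
  rwa [h2, neg_neg] at h1

/-- Translates of a function with a weak derivative are strongly differentiable in `L²`. -/
lemma HasWeakDeriv.hasDerivAt_translate (h : HasWeakDeriv e f g) (t : ℝ) :
    HasDerivAt (fun t : ℝ => translate (t • e) f) (translate (t • e) g) t := by
  -- Weak differentiability becomes strong here: paired with any test function both sides have the
  -- same derivative in `t` and agree at `0`, and test functions are dense.
  have key : ∀ t : ℝ, translate (t • e) f = f + ∫ s in (0 : ℝ)..t, translate (s • e) g := by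
    intro t
    refine (Lp.dense_hasCompactSupport_contDiff (F := ℝ) (μ := (volume : Measure V))
      (p := 2) (by simp)).eq_of_inner_left (𝕜 := ℝ) ?_
    rintro ψ ⟨ψ', hψ, hc, hd⟩
    have hG : ∀ t : ℝ, HasDerivAt
        (fun t : ℝ => inner ℝ (f + ∫ s in (0 : ℝ)..t, translate (s • e) g) ψ)
        (inner ℝ (translate (t • e) g) ψ) t := by
      intro t
      have h1 := (continuous_translate e g).integral_hasStrictDerivAt 0 t |>.hasDerivAt
      simpa using (h1.const_add f).inner ℝ (hasDerivAt_const t ψ)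
    have hF := h.hasDerivAt_inner_translate hψ (hd.of_le (by simp)) hc
    have hconst := is_const_of_deriv_eq_zero
      (f := fun t : ℝ => inner ℝ (translate (t • e) f) ψ -
        inner ℝ (f + ∫ s in (0 : ℝ)..t, translate (s • e) g) ψ)
      (fun t => ((hF t).sub (hG t)).differentiableAt)
      (fun t => ((hF t).sub (hG t)).deriv.trans (sub_self _)) t 0
    simp only [zero_smul, translate_zero, intervalIntegral.integral_same, add_zero,
      sub_self, sub_eq_zero] at hconst
    exact hconst
  rw [funext key]
  exact (((continuous_translate e g).integral_hasStrictDerivAt 0 t).hasDerivAt).const_add f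

lemma HasWeakDeriv.norm_translate_sub_le (h : HasWeakDeriv e f g) :
    ‖translate e f - f‖ ≤ ‖g‖ := by
  have := norm_image_sub_le_of_norm_deriv_le_segment_01'
    (f := fun t : ℝ => translate (t • e) f) (C := ‖g‖)
    (fun t _ => (h.hasDerivAt_translate t).hasDerivWithinAt)
    (fun t _ => by simp)
  simpa [translate_zero] using this

/-- Translations are isometries, so the inner product of the two translated functions is constant in
`t`; the product rule at `t = 0` is integration by parts, with no mollification. -/
lemma HasWeakDeriv.inner_eq_neg {k l : Lp ℝ 2 (volume : Measure V)} (h : HasWeakDeriv e f g)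
    (h' : HasWeakDeriv e k l) : inner ℝ f l = - inner ℝ g k := by
  have h1 := (h.hasDerivAt_translate 0).inner ℝ (h'.hasDerivAt_translate 0)
  simp only [LinearIsometry.inner_map_map] at h1
  have := h1.unique (hasDerivAt_const _ _)
  linarith

end Translation

/-! ### Sub-mean value property and decay of integrable subharmonic functions -/

section Subharmonic

variable {n : ℕ}

/-- The `i`-th vector of the standard basis. -/
abbrev basisVec (i : Fin n) : E n := EuclideanSpace.single i 1

lemma sum_smul_basisVec (y : E n) : ∑ i, y i • basisVec i = y := by
  simpa using (EuclideanSpace.basisFun (Fin n) ℝ).sum_repr y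

/-- The Laplacian, as the sum of the second partial derivatives. -/
def lap (u : E n → ℝ) (x : E n) : ℝ :=
  ∑ i, fderiv ℝ (fun y => fderiv ℝ u y (basisVec i)) x (basisVec i)

lemma contDiff_fderiv_apply {u : E n → ℝ} (hu : ContDiff ℝ 2 u) (e : E n) :
    ContDiff ℝ 1 fun y => fderiv ℝ u y e :=
  (hu.fderiv_right (m := 1) (by norm_num)).clm_apply contDiff_const

lemma continuous_lap {u : E n → ℝ} (hu : ContDiff ℝ 2 u) : Continuous (lap u) := by
  unfold lap
  refine continuous_finsetSum _ fun i _ => ?_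
  exact ((contDiff_fderiv_apply hu _).continuous_fderiv one_ne_zero).clm_apply continuous_const

lemma trace_hessian {u : E n → ℝ} (hu : ContDiff ℝ 2 u) (x : E n) :
    (hessian u x).trace = lap u x := by
  unfold hessian lap Matrix.trace
  refine Finset.sum_congr rfl fun i _ => ?_
  have h1 : DifferentiableAt ℝ (fderiv ℝ u) x :=
    ((hu.fderiv_right (m := 1) (by norm_num)).differentiable one_ne_zero) x
  rw [fderiv_clm_apply h1 (by fun_prop)]
  simp [iteratedFDeriv_two_apply]

/-- A nonnegative weight supported in the unit ball. -/
def ballWeight (y : E n) : ℝ := 2 * max 0 (1 - ‖y‖ ^ 2)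

/-- A potential of the vector field `y ↦ - ballWeight y • y`. -/
def ballPotential (y : E n) : ℝ := max 0 (1 - ‖y‖ ^ 2) ^ 2 / 2

lemma continuous_ballWeight : Continuous (ballWeight (n := n)) := by
  unfold ballWeight; fun_prop

lemma continuous_ballPotential : Continuous (ballPotential (n := n)) := by
  unfold ballPotential; fun_prop

lemma ballWeight_nonneg (y : E n) : 0 ≤ ballWeight y := by unfold ballWeight; positivity

lemma ballWeight_le (y : E n) : ballWeight y ≤ 2 := by
  unfold ballWeight
  have : max 0 (1 - ‖y‖ ^ 2) ≤ 1 := max_le zero_le_one (by nlinarith [sq_nonneg ‖y‖])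
  linarith

lemma ballPotential_nonneg (y : E n) : 0 ≤ ballPotential y := by unfold ballPotential; positivity

lemma max_one_sub_norm_sq_eq_zero {y : E n} (hy : y ∉ Metric.closedBall (0 : E n) 1) :
    max 0 (1 - ‖y‖ ^ 2) = 0 := by
  rw [mem_closedBall_zero_iff, not_le] at hy
  exact max_eq_left (by nlinarith)

lemma ballWeight_eq_zero {y : E n} (hy : y ∉ Metric.closedBall (0 : E n) 1) :
    ballWeight y = 0 := by
  simp [ballWeight, max_one_sub_norm_sq_eq_zero hy]

lemma ballPotential_eq_zero {y : E n} (hy : y ∉ Metric.closedBall (0 : E n) 1) :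
    ballPotential y = 0 := by
  simp [ballPotential, max_one_sub_norm_sq_eq_zero hy]

lemma hasCompactSupport_ballWeight : HasCompactSupport (ballWeight (n := n)) :=
  HasCompactSupport.intro (isCompact_closedBall 0 1) fun _ => ballWeight_eq_zero

lemma hasCompactSupport_ballPotential : HasCompactSupport (ballPotential (n := n)) :=
  HasCompactSupport.intro (isCompact_closedBall 0 1) fun _ => ballPotential_eq_zero

lemma integral_ballWeight_pos : 0 < ∫ y : E n, ballWeight y :=
  continuous_ballWeight.integral_pos_of_hasCompactSupport_nonneg_nonzero
    hasCompactSupport_ballWeight ballWeight_nonneg (x := 0) (by simp [ballWeight])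

lemma hasDerivAt_max_zero_sq (s : ℝ) :
    HasDerivAt (fun s : ℝ => max 0 s ^ 2) (2 * max 0 s) s := by
  rcases lt_trichotomy s 0 with h | h | h
  · rw [max_eq_left h.le, mul_zero]
    refine (hasDerivAt_const s (0 : ℝ)).congr_of_eventuallyEq ?_
    filter_upwards [gt_mem_nhds h] with t ht
    simp [max_eq_left (le_of_lt ht)]
  · subst h
    rw [hasDerivAt_iff_isLittleO]
    refine Asymptotics.IsBigO.trans_isLittleO (g := fun x : ℝ => x ^ 2) ?_ ?_
    · refine Asymptotics.IsBigO.of_bound 1 (Eventually.of_forall fun x => ?_)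
      simp only [max_self, mul_zero, smul_zero, sub_zero, one_mul, norm_pow]
      norm_num
      rw [← sq_abs x, sq_le_sq, abs_abs]
      rcases le_total 0 x with hx | hx <;> simp [hx]
    · simpa using Asymptotics.isLittleO_pow_id (𝕜 := ℝ) one_lt_two
  · rw [max_eq_right h.le]
    have := hasDerivAt_pow 2 s
    simp only [Nat.cast_ofNat, Nat.add_one_sub_one, pow_one] at this
    refine this.congr_of_eventuallyEq ?_
    filter_upwards [lt_mem_nhds h] with t ht
    simp [max_eq_right (le_of_lt ht)]

lemma hasFDerivAt_ballPotential (y : E n) :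
    HasFDerivAt ballPotential (-(ballWeight y) • innerSL ℝ y) y := by
  have h1 : HasFDerivAt (fun y : E n => 1 - ‖y‖ ^ 2) (-(2 • innerSL ℝ y)) y :=
    (hasStrictFDerivAt_norm_sq y).hasFDerivAt.const_sub 1
  have h2 := ((hasDerivAt_max_zero_sq (1 - ‖y‖ ^ 2)).comp_hasFDerivAt y h1).mul_const (1 / 2 : ℝ)
  convert! h2 using 1
  · ext z; simp [ballPotential, div_eq_mul_inv]
  · ext z; simp [ballWeight]; ring

/-- The field `-ballWeight y • y` is the gradient of `ballPotential`, so integration by parts turns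
the radial derivative into a Laplacian; the factor `r` comes from the chain rule. -/
lemma integral_fderiv_mul_ballWeight {u : E n → ℝ} (hu : ContDiff ℝ 2 u) (x : E n) (r : ℝ) :
    ∫ y, fderiv ℝ u (x + r • y) y * ballWeight y =
      r * ∫ y, lap u (x + r • y) * ballPotential y := by
  have hline : ∀ y : E n, HasFDerivAt (fun y : E n => x + r • y)
      (r • ContinuousLinearMap.id ℝ (E n)) y := fun y =>
    ((hasFDerivAt_id y).const_smul r).const_add x
  have hdiff : ∀ (i : Fin n) (y : E n), HasFDerivAt
      (fun y => fderiv ℝ u (x + r • y) (basisVec i))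
      ((fderiv ℝ (fun z => fderiv ℝ u z (basisVec i)) (x + r • y)).comp
        (r • ContinuousLinearMap.id ℝ (E n))) y := fun i y =>
    (((contDiff_fderiv_apply hu (basisVec i)).differentiable one_ne_zero) _).hasFDerivAt.comp y
      (hline y)
  have hc1 : ∀ i : Fin n, Continuous fun y => fderiv ℝ u (x + r • y) (basisVec i) := fun i =>
    (contDiff_fderiv_apply hu (basisVec i)).continuous.comp (by fun_prop)
  have hc2 : ∀ i : Fin n, Continuous fun y =>
      fderiv ℝ (fun z => fderiv ℝ u z (basisVec i)) (x + r • y) (basisVec i) := fun i =>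
    (((contDiff_fderiv_apply hu (basisVec i)).continuous_fderiv one_ne_zero).comp
      (by fun_prop)).clm_apply continuous_const
  have hi1 : ∀ i : Fin n, Integrable fun y : E n =>
      fderiv ℝ u (x + r • y) (basisVec i) * (-ballWeight y * y i) := fun i =>
    Continuous.integrable_of_hasCompactSupport
      ((hc1 i).mul (continuous_ballWeight.neg.mul (by fun_prop)))
      ((hasCompactSupport_ballWeight.neg.mul_right).mul_left)
  have hi2 : ∀ i : Fin n, Integrable fun y : E n =>
      r * fderiv ℝ (fun z => fderiv ℝ u z (basisVec i)) (x + r • y) (basisVec i) *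
        ballPotential y := fun i =>
    Continuous.integrable_of_hasCompactSupport
      ((continuous_const.mul (hc2 i)).mul continuous_ballPotential)
      hasCompactSupport_ballPotential.mul_left
  have ibp : ∀ i : Fin n,
      ∫ y, fderiv ℝ u (x + r • y) (basisVec i) * (-ballWeight y * y i) =
        - ∫ y, r * fderiv ℝ (fun z => fderiv ℝ u z (basisVec i)) (x + r • y) (basisVec i) *
          ballPotential y := by
    intro i
    have e1 : ∀ y : E n, fderiv ℝ ballPotential y (basisVec i) = -ballWeight y * y i := by
      intro y
      rw [(hasFDerivAt_ballPotential y).fderiv]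
      simp [EuclideanSpace.inner_single_right]
    have e2 : ∀ y : E n, fderiv ℝ (fun y => fderiv ℝ u (x + r • y) (basisVec i)) y (basisVec i) =
        r * fderiv ℝ (fun z => fderiv ℝ u z (basisVec i)) (x + r • y) (basisVec i) := by
      intro y
      rw [(hdiff i y).fderiv]
      simp
    have hi1' := hi1 i
    have hi2' := hi2 i
    simp only [← e1, ← e2] at hi1' hi2' ⊢
    exact integral_mul_fderiv_eq_neg_fderiv_mul_of_integrable hi2' hi1'
      (Continuous.integrable_of_hasCompactSupport ((hc1 i).mul continuous_ballPotential)
        hasCompactSupport_ballPotential.mul_left)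
      (fun y _ => (hdiff i y).differentiableAt)
      (fun y _ => (hasFDerivAt_ballPotential y).differentiableAt)
  calc ∫ y, fderiv ℝ u (x + r • y) y * ballWeight y
      = ∫ y, -∑ i, fderiv ℝ u (x + r • y) (basisVec i) * (-ballWeight y * y i) := by
        refine integral_congr_ae (ae_of_all _ fun y => ?_)
        have hsum : fderiv ℝ u (x + r • y) y =
            ∑ i, y i * fderiv ℝ u (x + r • y) (basisVec i) := by
          simpa using congrArg (fderiv ℝ u (x + r • y)) (sum_smul_basisVec y).symm
        simp only [hsum]
        rw [Finset.sum_mul, ← Finset.sum_neg_distrib]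
        exact Finset.sum_congr rfl fun i _ => by ring
    _ = ∑ i, ∫ y, r * fderiv ℝ (fun z => fderiv ℝ u z (basisVec i)) (x + r • y) (basisVec i) *
          ballPotential y := by
        rw [integral_neg, integral_finsetSum _ fun i _ => hi1 i, ← Finset.sum_neg_distrib]
        simp only [ibp, neg_neg]
    _ = r * ∫ y, lap u (x + r • y) * ballPotential y := by
        rw [← integral_finsetSum _ fun i _ => hi2 i, ← integral_const_mul]
        refine integral_congr_ae (ae_of_all _ fun y => ?_)
        simp only [lap, Finset.sum_mul, Finset.mul_sum, mul_assoc]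

lemma hasDerivAt_integral_comp_mul_ballWeight {u : E n → ℝ} (hu : ContDiff ℝ 2 u) (x : E n)
    (r : ℝ) :
    HasDerivAt (fun r : ℝ => ∫ y, u (x + r • y) * ballWeight y)
      (r * ∫ y, lap u (x + r • y) * ballPotential y) r := by
  rw [← integral_fderiv_mul_ballWeight hu]
  have hu' : Continuous (fderiv ℝ u) := hu.continuous_fderiv two_ne_zero
  have hcont : Continuous fun p : ℝ × E n => fderiv ℝ u (x + p.1 • p.2) p.2 :=
    (hu'.comp (by fun_prop)).clm_apply continuous_snd
  obtain ⟨C, hC⟩ := ((isCompact_closedBall r 1).prod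
    (isCompact_closedBall (0 : E n) 1)).exists_bound_of_continuousOn hcont.continuousOn
  have hint : ∀ r : ℝ, Integrable fun y : E n => u (x + r • y) * ballWeight y := fun r =>
    Continuous.integrable_of_hasCompactSupport
      ((hu.continuous.comp (by fun_prop)).mul continuous_ballWeight)
      hasCompactSupport_ballWeight.mul_left
  refine (hasDerivAt_integral_of_dominated_loc_of_deriv_le
    (F := fun r y => u (x + r • y) * ballWeight y)
    (F' := fun r y => fderiv ℝ u (x + r • y) y * ballWeight y)
    (bound := fun y => C * ballWeight y) (s := Metric.closedBall r 1)
    (Metric.closedBall_mem_nhds r one_pos)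
    (Eventually.of_forall fun r => (hint r).aestronglyMeasurable) (hint r) ?_ ?_ ?_ ?_).2
  · exact (((hu'.comp (by fun_prop)).clm_apply continuous_id).mul
      continuous_ballWeight).aestronglyMeasurable
  · refine ae_of_all _ fun y s hs => ?_
    rw [norm_mul, Real.norm_of_nonneg (ballWeight_nonneg y)]
    by_cases hy : y ∈ Metric.closedBall (0 : E n) 1
    · exact mul_le_mul_of_nonneg_right (hC (s, y) ⟨hs, hy⟩) (ballWeight_nonneg y)
    · simp [ballWeight_eq_zero hy]
  · exact (continuous_ballWeight.integrable_of_hasCompactSupport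
      hasCompactSupport_ballWeight).const_mul C
  · refine ae_of_all _ fun y s _ => ?_
    have h1 : HasDerivAt (fun s : ℝ => x + s • y) y s := by
      simpa using ((hasDerivAt_id s).smul_const y).const_add x
    exact (((hu.differentiable two_ne_zero) _).hasFDerivAt.comp_hasDerivAt s h1).mul_const _

/-- A sub-mean value property of subharmonic functions. -/
lemma mul_integral_ballWeight_le {u : E n → ℝ} (hu : ContDiff ℝ 2 u) (x : E n)
    (hx : ∀ y ∈ Metric.closedBall x 1, 0 ≤ lap u y) :
    u x * ∫ y : E n, ballWeight y ≤ ∫ y, u (x + y) * ballWeight y := by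
  have hd := hasDerivAt_integral_comp_mul_ballWeight hu x
  -- The weighted mean at scale `r` has derivative `r ∫ Δu · ballPotential ≥ 0`; the claim compares
  -- the scales `0` and `1`.
  have hmono : MonotoneOn (fun r : ℝ => ∫ y, u (x + r • y) * ballWeight y) (Set.Icc 0 1) := by
    refine monotoneOn_of_deriv_nonneg (convex_Icc 0 1)
      (fun r _ => (hd r).continuousAt.continuousWithinAt)
      (fun r _ => (hd r).differentiableAt.differentiableWithinAt) fun r hr => ?_
    rw [interior_Icc] at hr
    rw [(hd r).deriv]
    refine mul_nonneg hr.1.le (integral_nonneg fun y => ?_)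
    by_cases hy : y ∈ Metric.closedBall (0 : E n) 1
    · refine mul_nonneg (hx _ ?_) (ballPotential_nonneg y)
      rw [mem_closedBall_zero_iff] at hy
      rw [mem_closedBall_iff_norm, add_sub_cancel_left, norm_smul, Real.norm_of_nonneg hr.1.le]
      exact mul_le_one₀ hr.2.le (norm_nonneg _) hy
    · simp [ballPotential_eq_zero hy]
  have := hmono (Set.left_mem_Icc.2 zero_le_one) (Set.right_mem_Icc.2 zero_le_one) zero_le_one
  simpa [integral_const_mul] using this

/-- An integrable nonnegative function that is subharmonic near infinity vanishes there. -/
lemma tendsto_zero_of_lap_nonneg {u : E n → ℝ} (hu : ContDiff ℝ 2 u) (hpos : ∀ x, 0 ≤ u x)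
    (hint : Integrable u) (hlap : ∀ᶠ x in cocompact (E n), 0 ≤ lap u x) :
    Tendsto u (cocompact (E n)) (𝓝 0) := by
  have hI := integral_ballWeight_pos (n := n)
  set I := ∫ y : E n, ballWeight y
  have htail : Tendsto (fun k : ℕ => ∫ y in {y : E n | (k : ℝ) ≤ ‖y‖}, u y) atTop (𝓝 0) := by
    have h := tendsto_setIntegral_of_antitone (μ := volume) (f := u)
      (s := fun k : ℕ => {y : E n | (k : ℝ) ≤ ‖y‖})
      (fun k => measurableSet_le measurable_const measurable_norm)
      (fun k l hkl y (hy : (l : ℝ) ≤ ‖y‖) => (Nat.cast_le.2 hkl).trans hy) ⟨0, hint.integrableOn⟩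
    have he : ⋂ k : ℕ, {y : E n | (k : ℝ) ≤ ‖y‖} = ∅ := by
      ext y
      obtain ⟨k, hk⟩ := exists_nat_gt ‖y‖
      simpa using ⟨k, hk⟩
    simpa [he] using h
  rw [Metric.tendsto_nhds]
  intro ε hε
  -- The `2` in the denominator offsets the bound `ballWeight ≤ 2`.
  obtain ⟨k, hk⟩ := (htail.eventually (gt_mem_nhds (show 0 < ε * I / 2 by positivity))).exists
  rw [← Metric.cobounded_eq_cocompact] at hlap ⊢
  obtain ⟨R, -, hR⟩ := (hasBasis_cobounded_norm (E := E n)).eventually_iff.1 hlap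
  -- The extra `1` keeps the whole unit ball about `x` in the region of subharmonicity and in the
  -- tail beyond radius `k`.
  refine (hasBasis_cobounded_norm (E := E n)).eventually_iff.2
    ⟨max (R + 1) (k + 1), trivial, fun x hx => ?_⟩
  have hx' : max (R + 1) ((k : ℝ) + 1) ≤ ‖x‖ := hx
  have hfar : ∀ y ∈ Metric.closedBall (0 : E n) 1, ‖x‖ - 1 ≤ ‖x + y‖ := by
    intro y hy
    rw [mem_closedBall_zero_iff] at hy
    have := norm_sub_le (x + y) y
    rw [add_sub_cancel_right] at this
    linarith
  have h1 := mul_integral_ballWeight_le hu x fun y hy => hR (by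
    have := hfar (y - x) (by rwa [mem_closedBall_zero_iff, ← mem_closedBall_iff_norm])
    rw [add_sub_cancel] at this
    exact Set.mem_ofPred.2 (by linarith [le_max_left (R + 1) ((k : ℝ) + 1)]))
  have h2 : ∫ y, u (x + y) * ballWeight y ≤ 2 * ∫ y in {y : E n | (k : ℝ) ≤ ‖y‖}, u y := by
    rw [← integral_indicator (measurableSet_le measurable_const measurable_norm),
      ← integral_const_mul,
      ← integral_add_left_eq_self (fun y => 2 * Set.indicator {y : E n | (k : ℝ) ≤ ‖y‖} u y) x]
    refine integral_mono ?_ ?_ fun y => ?_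
    · exact Continuous.integrable_of_hasCompactSupport
        ((hu.continuous.comp (by fun_prop)).mul continuous_ballWeight)
        hasCompactSupport_ballWeight.mul_left
    · exact ((hint.indicator (measurableSet_le measurable_const
        measurable_norm)).const_mul 2).comp_add_left x
    · by_cases hy : y ∈ Metric.closedBall (0 : E n) 1
      · have : x + y ∈ {y : E n | (k : ℝ) ≤ ‖y‖} := Set.mem_ofPred.2 (by
          linarith [hfar y hy, le_max_right (R + 1) ((k : ℝ) + 1)])
        simp only [Set.indicator_of_mem this]
        nlinarith [hpos (x + y), ballWeight_le y]
      · simp only [ballWeight_eq_zero hy, mul_zero]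
        exact mul_nonneg zero_le_two (Set.indicator_nonneg (fun z _ => hpos z) _)
  simp only [dist_zero_right, Real.norm_of_nonneg (hpos x)]
  have : u x * I < ε * I := by linarith
  exact lt_of_mul_lt_mul_right this hI.le

end Subharmonic

/-! ### Weak derivatives of square integrable functions -/

section WeakDeriv

variable {V : Type*} [NormedAddCommGroup V] [InnerProductSpace ℝ V] [FiniteDimensional ℝ V]
  [MeasurableSpace V] [BorelSpace V] {e : V} {f g k l : V → ℝ}

lemma HasWeakDeriv.congr {f' g' : V → ℝ} (h : HasWeakDeriv e f g) (hf : f' =ᵐ[volume] f)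
    (hg : g' =ᵐ[volume] g) : HasWeakDeriv e f' g' := by
  intro ψ hψ hc
  have h1 : ∫ x, f' x * fderiv ℝ ψ x e = ∫ x, f x * fderiv ℝ ψ x e :=
    integral_congr_ae (by filter_upwards [hf] with x hx; rw [hx])
  have h2 : ∫ x, g' x * ψ x = ∫ x, g x * ψ x :=
    integral_congr_ae (by filter_upwards [hg] with x hx; rw [hx])
  rw [h1, h2, h ψ hψ hc]

lemma HasWeakDeriv.toLp (h : HasWeakDeriv e f g) (hf : MemLp f 2 volume)
    (hg : MemLp g 2 volume) : HasWeakDeriv e (hf.toLp f) (hg.toLp g) :=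
  h.congr hf.coeFn_toLp hg.coeFn_toLp

lemma HasWeakDeriv.eLpNorm_translate_sub_le (h : HasWeakDeriv e f g) (hf : MemLp f 2 volume)
    (hg : MemLp g 2 volume) :
    eLpNorm (fun x => f (x + e) - f x) 2 volume ≤ eLpNorm g 2 volume := by
  have h1 := (h.toLp hf hg).norm_translate_sub_le
  rw [Lp.norm_def, Lp.norm_def, ENNReal.toReal_le_toReal (Lp.eLpNorm_ne_top _)
    (Lp.eLpNorm_ne_top _), eLpNorm_congr_ae hg.coeFn_toLp] at h1
  refine le_of_eq_of_le (eLpNorm_congr_ae ?_) h1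
  filter_upwards [Lp.coeFn_sub (translate e (hf.toLp f)) (hf.toLp f),
    coeFn_translate e (hf.toLp f), hf.coeFn_toLp,
    (measurePreserving_add_right volume e).quasiMeasurePreserving.ae_eq_comp hf.coeFn_toLp]
    with x h1 h2 h3 h4
  simp only [Function.comp_apply] at h4
  rw [h1, Pi.sub_apply, h2, h3, h4]

lemma HasWeakDeriv.integral_mul_eq_neg (h : HasWeakDeriv e f g) (h' : HasWeakDeriv e k l)
    (hf : MemLp f 2 volume) (hg : MemLp g 2 volume) (hk : MemLp k 2 volume)
    (hl : MemLp l 2 volume) : ∫ x, f x * l x = - ∫ x, g x * k x := by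
  have h1 := (h.toLp hf hg).inner_eq_neg (h'.toLp hk hl)
  rw [L2.inner_def, L2.inner_def] at h1
  have e1 : ∫ x, inner ℝ (hf.toLp f x) (hl.toLp l x) = ∫ x, f x * l x :=
    integral_congr_ae (by
      filter_upwards [hf.coeFn_toLp, hl.coeFn_toLp] with x h1 h2
      simp [h1, h2, mul_comm])
  have e2 : ∫ x, inner ℝ (hg.toLp g x) (hk.toLp k x) = ∫ x, g x * k x :=
    integral_congr_ae (by
      filter_upwards [hg.coeFn_toLp, hk.coeFn_toLp] with x h1 h2
      simp [h1, h2, mul_comm])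
  rwa [e1, e2] at h1

end WeakDeriv

/-! ### Local Sobolev functions and a Hardy type inequality -/

section LocalSobolev

variable {n : ℕ} {φ : E n → ℝ} {g : E n → E n}

/-- `φ` is locally square integrable with locally square integrable weak gradient `g`. -/
structure LocalSobolev (φ : E n → ℝ) (g : E n → E n) : Prop where
  measurable : Measurable φ
  measurable_grad : Measurable g
  sq : LocallyIntegrable fun x => φ x ^ 2
  sq_grad : LocallyIntegrable fun x => ‖g x‖ ^ 2
  integral_eq : ∀ ψ : E n → ℝ, ContDiff ℝ 1 ψ → HasCompactSupport ψ →
    ∫ x, φ x • gradient ψ x = - ∫ x, ψ x • g x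

lemma inner_gradient_left (ψ : E n → ℝ) (x e : E n) :
    inner ℝ (gradient ψ x) e = fderiv ℝ ψ x e := by
  simp [gradient]

lemma continuous_gradient {ψ : E n → ℝ} (hψ : ContDiff ℝ 1 ψ) : Continuous (gradient ψ) :=
  (InnerProductSpace.toDual ℝ (E n)).symm.continuous.comp (hψ.continuous_fderiv one_ne_zero)

lemma hasCompactSupport_gradient {ψ : E n → ℝ} (hψ : HasCompactSupport ψ) :
    HasCompactSupport (gradient ψ) :=
  (hψ.fderiv ℝ).comp_left (map_zero _)

lemma locallyIntegrable_of_sq {F : Type*} [NormedAddCommGroup F] {u : E n → F}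
    (hm : AEStronglyMeasurable u volume) (hu : LocallyIntegrable fun x => ‖u x‖ ^ 2) :
    LocallyIntegrable u := by
  refine ((locallyIntegrable_const (1 : ℝ)).add hu).mono hm (ae_of_all _ fun x => ?_)
  simp only [Pi.add_apply]
  rw [Real.norm_of_nonneg (by positivity)]
  nlinarith [sq_nonneg (‖u x‖ - 1), norm_nonneg (u x)]

namespace LocalSobolev

lemma locallyIntegrable (h : LocalSobolev φ g) : LocallyIntegrable φ :=
  locallyIntegrable_of_sq h.measurable.aestronglyMeasurable (by simpa using h.sq)

lemma locallyIntegrable_grad (h : LocalSobolev φ g) : LocallyIntegrable g :=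
  locallyIntegrable_of_sq h.measurable_grad.aestronglyMeasurable h.sq_grad

lemma integrable_sq_mul (h : LocalSobolev φ g) {η : E n → ℝ} (hη : Continuous η)
    (hc : HasCompactSupport η) : Integrable fun x => φ x ^ 2 * η x :=
  h.sq.integrable_smul_right_of_hasCompactSupport hη hc

lemma integrable_sq_grad_mul (h : LocalSobolev φ g) {η : E n → ℝ} (hη : Continuous η)
    (hc : HasCompactSupport η) : Integrable fun x => ‖g x‖ ^ 2 * η x :=
  h.sq_grad.integrable_smul_right_of_hasCompactSupport hη hc

lemma measurable_inner (h : LocalSobolev φ g) (e : E n) : Measurable fun x => inner ℝ (g x) e :=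
  h.measurable_grad.inner measurable_const

lemma integrable_mul_inner_mul (h : LocalSobolev φ g) (e : E n) {η : E n → ℝ}
    (hη : Continuous η) (hc : HasCompactSupport η) :
    Integrable fun x => φ x * inner ℝ (g x) e * η x := by
  refine (LocallyIntegrable.mono (h.sq.add (h.sq_grad.smul (‖e‖ ^ 2)))
    (h.measurable.mul (h.measurable_inner e)).aestronglyMeasurable
    (ae_of_all _ fun x => ?_)).integrable_smul_right_of_hasCompactSupport hη hc
  simp only [Pi.add_apply, Pi.smul_apply, smul_eq_mul, Pi.mul_apply]
  rw [Real.norm_of_nonneg (show 0 ≤ φ x ^ 2 + ‖e‖ ^ 2 * ‖g x‖ ^ 2 by positivity), norm_mul,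
    ← sq_abs (φ x), Real.norm_eq_abs]
  have h1 : ‖inner ℝ (g x) e‖ ≤ ‖g x‖ * ‖e‖ := norm_inner_le_norm _ _
  have h2 := mul_le_mul_of_nonneg_left h1 (abs_nonneg (φ x))
  nlinarith [sq_nonneg (|φ x| - ‖g x‖ * ‖e‖), sq_nonneg (‖g x‖ * ‖e‖), sq_nonneg (|φ x|)]

lemma integral_mul_fderiv (h : LocalSobolev φ g) (e : E n) {η : E n → ℝ}
    (hη : ContDiff ℝ 1 η) (hc : HasCompactSupport η) :
    ∫ x, φ x * fderiv ℝ η x e = - ∫ x, η x * inner ℝ (g x) e := by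
  have h1 := congrArg (fun w => inner ℝ e w) (h.integral_eq η hη hc)
  simp only [inner_neg_right] at h1
  rw [← integral_inner (h.locallyIntegrable.integrable_smul_right_of_hasCompactSupport
      (continuous_gradient hη) (hasCompactSupport_gradient hc)),
    ← integral_inner (h.locallyIntegrable_grad.integrable_smul_left_of_hasCompactSupport
      hη.continuous hc)] at h1
  have hcomm : ∀ w : E n, inner ℝ e w = inner ℝ w e := fun w => real_inner_comm w e
  simpa only [hcomm, real_inner_smul_left, inner_gradient_left] using h1

/-- The weak derivative of the product with a cutoff function. -/
lemma hasWeakDeriv_mul (h : LocalSobolev φ g) (e : E n) {ζ : E n → ℝ}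
    (hζ : ContDiff ℝ 1 ζ) (hc : HasCompactSupport ζ) :
    HasWeakDeriv e (fun x => ζ x * φ x)
      (fun x => ζ x * inner ℝ (g x) e + φ x * fderiv ℝ ζ x e) := by
  intro ψ hψ hcψ
  have h1 := h.integral_mul_fderiv e (hζ.mul hψ) hc.mul_right
  have hd : ∀ x, fderiv ℝ (fun x => ζ x * ψ x) x e =
      ζ x * fderiv ℝ ψ x e + ψ x * fderiv ℝ ζ x e := by
    intro x
    rw [fderiv_fun_mul ((hζ.differentiable one_ne_zero) x) ((hψ.differentiable one_ne_zero) x)]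
    simp
  simp only [hd, mul_add] at h1
  have hcζ : Continuous fun x => fderiv ℝ ζ x e :=
    (hζ.continuous_fderiv one_ne_zero).clm_apply continuous_const
  have hcψ' : Continuous fun x => fderiv ℝ ψ x e :=
    (hψ.continuous_fderiv one_ne_zero).clm_apply continuous_const
  have hi1 : Integrable fun x => φ x * (ζ x * fderiv ℝ ψ x e) :=
    h.locallyIntegrable.integrable_smul_right_of_hasCompactSupport (hζ.continuous.mul hcψ')
      hc.mul_right
  have hi2 : Integrable fun x => φ x * (ψ x * fderiv ℝ ζ x e) :=
    h.locallyIntegrable.integrable_smul_right_of_hasCompactSupport (hψ.continuous.mul hcζ)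
      hcψ.mul_right
  have hi3 : Integrable fun x => ζ x * ψ x * inner ℝ (g x) e := by
    have := (h.locallyIntegrable_grad.integrable_smul_left_of_hasCompactSupport
      (hζ.continuous.mul hψ.continuous) hc.mul_right).inner_const (𝕜 := ℝ) e
    simpa only [inner_smul_left, Pi.mul_apply, RCLike.conj_to_real] using this
  rw [integral_add hi1 hi2] at h1
  have e1 : ∫ x, ζ x * φ x * fderiv ℝ ψ x e = ∫ x, φ x * (ζ x * fderiv ℝ ψ x e) :=
    integral_congr_ae (ae_of_all _ fun x => by ring)
  have e2 : ∫ x, (ζ x * inner ℝ (g x) e + φ x * fderiv ℝ ζ x e) * ψ x =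
      (∫ x, ζ x * ψ x * inner ℝ (g x) e) + ∫ x, φ x * (ψ x * fderiv ℝ ζ x e) := by
    rw [← integral_add hi3 hi2]
    exact integral_congr_ae (ae_of_all _ fun x => by ring)
  rw [e1, e2]
  linarith

lemma memLp_mul (h : LocalSobolev φ g) {ζ : E n → ℝ} (hζ : Continuous ζ)
    (hc : HasCompactSupport ζ) : MemLp (fun x => ζ x * φ x) 2 volume := by
  refine (memLp_two_iff_integrable_sq
    (hζ.measurable.mul h.measurable).aestronglyMeasurable).2 ?_
  refine (h.integrable_sq_mul (hζ.mul hζ) hc.mul_left).congr (ae_of_all _ fun x => ?_)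
  simp only [Pi.mul_apply]
  ring

lemma memLp_mul_inner (h : LocalSobolev φ g) (e : E n) {ζ : E n → ℝ} (hζ : Continuous ζ)
    (hc : HasCompactSupport ζ) : MemLp (fun x => ζ x * inner ℝ (g x) e) 2 volume := by
  refine (memLp_two_iff_integrable_sq
    (hζ.measurable.mul (h.measurable_inner e)).aestronglyMeasurable).2 ?_
  refine ((h.integrable_sq_grad_mul (hζ.mul hζ) hc.mul_left).const_mul (‖e‖ ^ 2)).mono
    ((hζ.measurable.mul (h.measurable_inner e)).pow_const 2).aestronglyMeasurable
    (ae_of_all _ fun x => ?_)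
  simp only [Pi.mul_apply]
  rw [Real.norm_of_nonneg (sq_nonneg _), Real.norm_of_nonneg
    (mul_nonneg (sq_nonneg _) (mul_nonneg (sq_nonneg _) (mul_self_nonneg _)))]
  have h1 : |inner ℝ (g x) e| ≤ ‖g x‖ * ‖e‖ := abs_real_inner_le_norm _ _
  have h2 : inner ℝ (g x) e ^ 2 ≤ (‖g x‖ * ‖e‖) ^ 2 := sq_le_sq.2 (h1.trans (le_abs_self _))
  nlinarith [mul_le_mul_of_nonneg_left h2 (sq_nonneg (ζ x))]

lemma memLp_deriv_mul (h : LocalSobolev φ g) (e : E n) {ζ : E n → ℝ}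
    (hζ : ContDiff ℝ 1 ζ) (hc : HasCompactSupport ζ) :
    MemLp (fun x => ζ x * inner ℝ (g x) e + φ x * fderiv ℝ ζ x e) 2 volume := by
  refine (h.memLp_mul_inner e hζ.continuous hc).add ?_
  have := h.memLp_mul (ζ := fun x => fderiv ℝ ζ x e)
    ((hζ.continuous_fderiv one_ne_zero).clm_apply continuous_const) (hc.fderiv_apply ℝ e)
  exact this.ae_eq (ae_of_all _ fun x => mul_comm _ _)

/-- `2 φ ∇φ` is the weak gradient of `φ ^ 2`. -/
lemma integral_sq_mul_fderiv (h : LocalSobolev φ g) (e : E n) {η : E n → ℝ}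
    (hη : ContDiff ℝ 1 η) (hc : HasCompactSupport η) :
    ∫ x, φ x ^ 2 * fderiv ℝ η x e = - (2 * ∫ x, φ x * inner ℝ (g x) e * η x) := by
  obtain ⟨R, hR⟩ := hc.isCompact.isBounded.subset_ball (0 : E n)
  -- As `φ` is only locally in `L²`, integration by parts is applied to `ζ φ` and `η φ`; `ζ` is `1`
  -- near the support of `η` and disappears from the result.
  let ζ : ContDiffBump (0 : E n) := ⟨max R 1, max R 1 + 1, by positivity, by linarith⟩
  have hζ : ContDiff ℝ 1 ζ := ζ.contDiff
  have hcζ : HasCompactSupport ζ := ζ.hasCompactSupport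
  have hone : ∀ x, x ∈ tsupport η → ζ =ᶠ[𝓝 x] 1 := fun x hx =>
    ζ.eventuallyEq_one_of_mem_ball (Metric.ball_subset_ball (le_max_left R 1) (hR hx))
  have key := (h.hasWeakDeriv_mul e hζ hcζ).integral_mul_eq_neg (h.hasWeakDeriv_mul e hη hc)
    (h.memLp_mul hζ.continuous hcζ) (h.memLp_deriv_mul e hζ hcζ)
    (h.memLp_mul hη.continuous hc) (h.memLp_deriv_mul e hη hc)
  have e1 : ∀ x, ζ x * φ x * (η x * inner ℝ (g x) e + φ x * fderiv ℝ η x e) =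
      φ x * inner ℝ (g x) e * η x + φ x ^ 2 * fderiv ℝ η x e := by
    intro x
    by_cases hx : x ∈ tsupport η
    · rw [(hone x hx).eq_of_nhds]; simp; ring
    · rw [image_eq_zero_of_notMem_tsupport hx, fderiv_of_notMem_tsupport ℝ hx]; simp
  have e2 : ∀ x, (ζ x * inner ℝ (g x) e + φ x * fderiv ℝ ζ x e) * (η x * φ x) =
      φ x * inner ℝ (g x) e * η x := by
    intro x
    by_cases hx : x ∈ tsupport η
    · rw [(hone x hx).fderiv_eq, (hone x hx).eq_of_nhds]; simp; ring
    · rw [image_eq_zero_of_notMem_tsupport hx]; simp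
  simp only [e1, e2] at key
  rw [integral_add (h.integrable_mul_inner_mul e hη.continuous hc) (h.integrable_sq_mul
    ((hη.continuous_fderiv one_ne_zero).clm_apply continuous_const) (hc.fderiv_apply ℝ e))] at key
  linarith

/-- A Hardy type inequality with weight `ω` and vector field `∇h / 2`. -/
lemma hardy (hφ : LocalSobolev φ g) {ω h : E n → ℝ} (hω : ContDiff ℝ 1 ω)
    (hc : HasCompactSupport ω) (hpos : ∀ x, 0 ≤ ω x) (hh : ContDiff ℝ 2 h) :
    ∫ x, φ x ^ 2 * (-(fderiv ℝ ω x (gradient h x) + ω x * lap h x) / 2 -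
        ω x * ‖gradient h x‖ ^ 2 / 4) ≤
      ∫ x, ‖g x‖ ^ 2 * ω x := by
  have hh1 : ContDiff ℝ 1 h := hh.of_le (by norm_num)
  have hgh : Continuous (gradient h) := continuous_gradient hh1
  have hcoord : ∀ x w : E n, inner ℝ w (gradient h x) =
      ∑ i, inner ℝ w (basisVec i) * fderiv ℝ h x (basisVec i) := by
    intro x w
    rw [real_inner_comm, inner_gradient_left]
    conv_lhs => rw [← sum_smul_basisVec w]
    simp [EuclideanSpace.inner_single_right]
  have hdω : ∀ x, fderiv ℝ ω x (gradient h x) =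
      ∑ i, fderiv ℝ ω x (basisVec i) * fderiv ℝ h x (basisVec i) := by
    intro x
    simp only [← inner_gradient_left ω]
    exact hcoord x _
  have hη : ∀ i : Fin n, ContDiff ℝ 1 fun x => ω x * fderiv ℝ h x (basisVec i) := fun i =>
    hω.mul (contDiff_fderiv_apply hh _)
  have hηc : ∀ i : Fin n, HasCompactSupport fun x => ω x * fderiv ℝ h x (basisVec i) :=
    fun i => hc.mul_right
  have hcross : Integrable fun x => φ x * inner ℝ (g x) (gradient h x) * ω x := by
    have : Integrable fun x => ∑ i : Fin n,
        φ x * inner ℝ (g x) (basisVec i) * (ω x * fderiv ℝ h x (basisVec i)) :=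
      integrable_finsetSum _ fun i _ =>
        hφ.integrable_mul_inner_mul (basisVec i) (hη i).continuous (hηc i)
    refine this.congr (ae_of_all _ fun x => ?_)
    simp only [hcoord, Finset.mul_sum, Finset.sum_mul]
    exact Finset.sum_congr rfl fun i _ => by ring
  have hA : Continuous fun x => fderiv ℝ ω x (gradient h x) + ω x * lap h x :=
    ((hω.continuous_fderiv one_ne_zero).clm_apply hgh).add
      (hω.continuous.mul (continuous_lap hh))
  have hAc : HasCompactSupport fun x => fderiv ℝ ω x (gradient h x) + ω x * lap h x := by
    refine HasCompactSupport.add ?_ hc.mul_right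
    exact (hc.fderiv ℝ).mono' fun x hx => by
      by_contra hx'
      apply hx
      simp [image_eq_zero_of_notMem_tsupport hx']
  -- This is `∫ φ² div(ω ∇h) = -2 ∫ φ ∇φ·∇h ω`, obtained coordinate by coordinate.
  have hdiv : ∫ x, φ x ^ 2 * (fderiv ℝ ω x (gradient h x) + ω x * lap h x) =
      - (2 * ∫ x, φ x * inner ℝ (g x) (gradient h x) * ω x) := by
    have h1 : ∀ i : Fin n, _ := fun i => hφ.integral_sq_mul_fderiv (basisVec i) (hη i) (hηc i)
    have h2 := Finset.sum_congr (rfl : (Finset.univ : Finset (Fin n)) = _) fun i _ => h1 i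
    rw [Finset.sum_neg_distrib, ← Finset.mul_sum, ← integral_finsetSum, ← integral_finsetSum] at h2
    · refine Eq.trans (integral_congr_ae (ae_of_all _ fun x => ?_))
        (h2.trans (congrArg (fun s => -(2 * s)) (integral_congr_ae (ae_of_all _ fun x => ?_))))
      · simp only
        rw [← Finset.mul_sum]
        congr 1
        rw [hdω, lap, Finset.mul_sum, ← Finset.sum_add_distrib]
        refine Finset.sum_congr rfl fun i _ => ?_
        rw [fderiv_fun_mul ((hω.differentiable one_ne_zero) x)
          (((contDiff_fderiv_apply hh _).differentiable one_ne_zero) x)]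
        simp
        ring
      · simp only [hcoord, Finset.mul_sum, Finset.sum_mul]
        exact Finset.sum_congr rfl fun i _ => by ring
    · exact fun i _ => hφ.integrable_mul_inner_mul (basisVec i) (hη i).continuous (hηc i)
    · exact fun i _ => hφ.integrable_sq_mul
        (((hη i).continuous_fderiv one_ne_zero).clm_apply continuous_const)
        ((hηc i).fderiv_apply ℝ _)
  have hB : Integrable fun x => φ x ^ 2 * (ω x * ‖gradient h x‖ ^ 2) :=
    hφ.integrable_sq_mul (hω.continuous.mul (hgh.norm.pow 2)) hc.mul_right
  have hA' := hφ.integrable_sq_mul hA hAc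
  calc ∫ x, φ x ^ 2 * (-(fderiv ℝ ω x (gradient h x) + ω x * lap h x) / 2 -
        ω x * ‖gradient h x‖ ^ 2 / 4)
      = (-1 / 2) * (∫ x, φ x ^ 2 * (fderiv ℝ ω x (gradient h x) + ω x * lap h x)) -
          (1 / 4) * ∫ x, φ x ^ 2 * (ω x * ‖gradient h x‖ ^ 2) := by
        rw [← integral_const_mul, ← integral_const_mul,
          ← integral_sub (hA'.const_mul _) (hB.const_mul _)]
        exact integral_congr_ae (ae_of_all _ fun x => by ring)
    _ = ∫ x, (φ x * inner ℝ (g x) (gradient h x) * ω x -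
          (1 / 4) * (φ x ^ 2 * (ω x * ‖gradient h x‖ ^ 2))) := by
        rw [hdiv, integral_sub hcross (hB.const_mul _), integral_const_mul]
        ring
    _ ≤ ∫ x, ‖g x‖ ^ 2 * ω x := by
        refine integral_mono (hcross.sub (hB.const_mul _))
          (hφ.integrable_sq_grad_mul hω.continuous hc) fun x => ?_
        have h1 : 0 ≤ ‖g x - (φ x / 2) • gradient h x‖ ^ 2 := sq_nonneg _
        rw [norm_sub_sq_real, inner_smul_right, norm_smul, mul_pow, Real.norm_eq_abs, sq_abs] at h1
        have h2 := mul_nonneg (hpos x) h1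
        simp only
        nlinarith

end LocalSobolev

end LocalSobolev

/-! ### Local compactness by averaging over small balls -/

section Rellich

variable {V : Type*} [NormedAddCommGroup V] [InnerProductSpace ℝ V] [FiniteDimensional ℝ V]
  [MeasurableSpace V] [BorelSpace V]

/-- A compact set has a measurable partition into finitely many pieces of small diameter. -/
lemma exists_measurable_index {K : Set V} (hK : IsCompact K) {δ : ℝ} (hδ : 0 < δ) :
    ∃ (m : ℕ) (pt : Fin m → V) (p : V → Fin m), Measurable p ∧ ∀ x ∈ K, dist x (pt (p x)) < δ := by
  let e : ℕ → V := TopologicalSpace.denseSeq V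
  obtain ⟨N, hN⟩ := hK.elim_directed_cover (fun N : ℕ => ⋃ k ≤ N, Metric.ball (e k) δ)
    (fun N => isOpen_biUnion fun _ _ => Metric.isOpen_ball)
    (fun x _ => by
      obtain ⟨k, hk⟩ := (TopologicalSpace.denseRange_denseSeq V).exists_dist_lt x hδ
      exact Set.mem_iUnion.2 ⟨k, Set.mem_iUnion₂.2 ⟨k, le_rfl, hk⟩⟩)
    (directed_of_isDirected_le fun a b hab =>
      Set.biUnion_subset_biUnion_left fun k (hk : k ≤ a) => hk.trans hab)
  -- Each point is sent to the index of its nearest centre among the first `N + 1`. The index is at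
  -- most `N`, so the reduction in `Fin.ofNat` changes nothing.
  refine ⟨N + 1, fun i => e i, fun x => Fin.ofNat (N + 1) (SimpleFunc.nearestPtInd e N x),
    (Measurable.of_discrete (f := Fin.ofNat (N + 1))).comp (SimpleFunc.nearestPtInd e N).measurable,
    fun x hx => ?_⟩
  · obtain ⟨k, hk, hxk⟩ := Set.mem_iUnion₂.1 (hN hx)
    have h := SimpleFunc.edist_nearestPt_le e x hk
    rw [edist_dist, edist_dist, ENNReal.ofReal_le_ofReal_iff dist_nonneg, dist_comm,
      dist_comm (e k)] at h
    simp only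
    rw [Fin.val_ofNat, Nat.mod_eq_of_lt (Nat.lt_succ_of_le (SimpleFunc.nearestPtInd_le e N x))]
    exact h.trans_lt hxk

lemma sq_setAverage_le {s : Set V} (hs0 : volume s ≠ 0) (hs : volume s ≠ ⊤) {f : V → ℝ}
    (hf : MemLp f 2 (volume.restrict s)) : (⨍ y in s, f y) ^ 2 ≤ ⨍ y in s, f y ^ 2 := by
  have : IsFiniteMeasure (volume.restrict s) := ⟨by simpa using hs.lt_top⟩
  have : NeZero (volume.restrict s) := ⟨by simpa using hs0⟩
  exact (even_two.convexOn_pow (𝕜 := ℝ)).map_average_le (by fun_prop) isClosed_univ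
    (ae_of_all _ fun _ => Set.mem_univ _) (hf.integrable one_le_two) hf.integrable_sq

/-- By Jensen the left side is at most the mean of `|ψ y - ψ x|²` over the ball about `a`, which
lies in the ball of radius `2 δ` about `x`. Centring at `x` leaves only translates, with a domain of
`z` independent of `x`. -/
lemma enorm_sub_setAverage_sq_le {ψ : V → ℝ} (hL : MemLp ψ 2 volume)
    {δ : ℝ} (hδ : 0 < δ) {x a : V} (hx : dist x a < δ) :
    ‖ψ x - ⨍ y in Metric.ball a δ, ψ y‖ₑ ^ 2 ≤
      (volume (Metric.ball (0 : V) δ))⁻¹ *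
        ∫⁻ z in Metric.ball (0 : V) (2 * δ), ‖ψ (x + z) - ψ x‖ₑ ^ 2 := by
  have hb0 : volume (Metric.ball a δ) ≠ 0 := (Metric.measure_ball_pos volume a hδ).ne'
  have hb : volume (Metric.ball a δ) ≠ ⊤ := measure_ball_lt_top.ne
  have : IsFiniteMeasure (volume.restrict (Metric.ball a δ)) := ⟨by simpa using hb.lt_top⟩
  have : NeZero (volume.restrict (Metric.ball a δ)) := ⟨by simpa using hb0⟩
  have hL' : MemLp (fun y => ψ y - ψ x) 2 (volume.restrict (Metric.ball a δ)) :=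
    (hL.restrict _).sub (memLp_const _)
  have h1 : ψ x - ⨍ y in Metric.ball a δ, ψ y = - ⨍ y in Metric.ball a δ, (ψ y - ψ x) := by
    have h := average_const (volume.restrict (Metric.ball a δ)) (ψ x)
    rw [average_eq] at h
    rw [average_eq, average_eq, integral_sub ((hL.restrict _).integrable one_le_two)
      (integrable_const _), smul_sub, h]
    ring
  have h2 : ∀ r : ℝ, ‖r‖ₑ ^ 2 = ENNReal.ofReal (r ^ 2) := fun r => by
    rw [← enorm_pow, Real.enorm_of_nonneg (sq_nonneg r)]
  rw [h1, enorm_neg, h2]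
  refine (ENNReal.ofReal_le_ofReal (sq_setAverage_le hb0 hb hL')).trans ?_
  rw [ofReal_setAverage (hL'.integrable_sq) (ae_of_all _ fun y => sq_nonneg _),
    ENNReal.div_eq_inv_mul, Measure.addHaar_ball_center volume a]
  gcongr _ * ?_
  have h3 : ∫⁻ z in Metric.ball (0 : V) (2 * δ), ‖ψ (x + z) - ψ x‖ₑ ^ 2 =
      ∫⁻ y in Metric.ball x (2 * δ), ‖ψ y - ψ x‖ₑ ^ 2 := by
    have := (measurePreserving_add_left volume x).setLIntegral_comp_preimage_emb
      (measurableEmbedding_addLeft x) (fun y => ‖ψ y - ψ x‖ₑ ^ 2) (Metric.ball x (2 * δ))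
    rw [← this]
    congr 2
    ext z
    simp
  rw [h3]
  simp only [h2]
  refine lintegral_mono_set (Metric.ball_subset_ball' ?_)
  rw [dist_comm]
  linarith

/-- Local compactness criterion of Kolmogorov and Riesz: functions that are bounded in `L²` and
uniformly close to their translates are, on a ball, uniformly close to functions that take
finitely many values on fixed sets. -/
theorem exists_step_approx (R C : ℝ) {ε : ℝ} (hε : 0 < ε) :
    ∃ (m : ℕ) (p : V → Fin m) (B : ℝ), Measurable p ∧
      ∀ ψ : V → ℝ, Measurable ψ → MemLp ψ 2 volume → ∫ x, ψ x ^ 2 ≤ C →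
        (∀ z, ∫⁻ x, ‖ψ (x + z) - ψ x‖ₑ ^ 2 ≤ ENNReal.ofReal (C * ‖z‖ ^ 2)) →
        ∃ c : Fin m → ℝ, (∀ i, |c i| ≤ B) ∧
          ∫⁻ x in Metric.closedBall 0 R, ‖ψ x - c (p x)‖ₑ ^ 2 ≤ ENNReal.ofReal ε := by
  -- `2 ^ finrank` is the volume ratio of balls of radii `2 δ` and `δ`; `C (2 δ)²` bounds the
  -- translation error for `‖z‖ < 2 δ`.
  obtain ⟨δ, hδ, hδε⟩ : ∃ δ : ℝ, 0 < δ ∧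
      2 ^ Module.finrank ℝ V * (C * (2 * δ) ^ 2) < ε := by
    have h : Tendsto (fun δ : ℝ => 2 ^ Module.finrank ℝ V * (C * (2 * δ) ^ 2)) (𝓝[>] 0) (𝓝 0) := by
      have : Continuous fun δ : ℝ => 2 ^ Module.finrank ℝ V * (C * (2 * δ) ^ 2) := by fun_prop
      simpa using (this.tendsto 0).mono_left nhdsWithin_le_nhds
    obtain ⟨δ, h1, h2⟩ := ((h.eventually (gt_mem_nhds hε)).and self_mem_nhdsWithin).exists
    exact ⟨δ, h2, h1⟩
  obtain ⟨m, pt, p, hp, hpt⟩ := exists_measurable_index (isCompact_closedBall (0 : V) R) hδ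
  set vδ := volume (Metric.ball (0 : V) δ) with hvδ
  have hv0 : vδ ≠ 0 := (Metric.measure_ball_pos volume 0 hδ).ne'
  have hv : vδ ≠ ⊤ := measure_ball_lt_top.ne
  -- The coefficients are ball averages; Jensen bounds their squares by `C` over the volume of the
  -- ball.
  refine ⟨m, p, √(vδ.toReal⁻¹ * C), hp, fun ψ hm hL hC hT =>
    ⟨fun i => ⨍ y in Metric.ball (pt i) δ, ψ y, fun i => ?_, ?_⟩⟩
  · refine Real.abs_le_sqrt ((sq_setAverage_le (Metric.measure_ball_pos volume _ hδ).ne'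
      measure_ball_lt_top.ne (hL.restrict _)).trans ?_)
    rw [setAverage_eq, smul_eq_mul, measureReal_def, Measure.addHaar_ball_center volume (pt i)]
    gcongr
    exact (setIntegral_le_integral hL.integrable_sq (ae_of_all _ fun _ => sq_nonneg _)).trans hC
  · have hmeas : Measurable (Function.uncurry fun x z => ‖ψ (x + z) - ψ x‖ₑ ^ 2) := by
      have h1 : Measurable fun q : V × V => ψ (q.1 + q.2) :=
        hm.comp (measurable_fst.add measurable_snd)
      have h2 : Measurable fun q : V × V => ψ q.1 := hm.comp measurable_fst
      exact (h1.sub h2).enorm.pow_const 2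
    calc ∫⁻ x in Metric.closedBall 0 R, ‖ψ x - ⨍ y in Metric.ball (pt (p x)) δ, ψ y‖ₑ ^ 2
        ≤ ∫⁻ x in Metric.closedBall 0 R,
            vδ⁻¹ * ∫⁻ z in Metric.ball (0 : V) (2 * δ), ‖ψ (x + z) - ψ x‖ₑ ^ 2 :=
          setLIntegral_mono' Metric.isClosed_closedBall.measurableSet fun x hx =>
            enorm_sub_setAverage_sq_le hL hδ (hpt x hx)
      _ ≤ ∫⁻ x, vδ⁻¹ * ∫⁻ z in Metric.ball (0 : V) (2 * δ), ‖ψ (x + z) - ψ x‖ₑ ^ 2 :=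
          setLIntegral_le_lintegral _ _
      _ = vδ⁻¹ * ∫⁻ z in Metric.ball (0 : V) (2 * δ), ∫⁻ x, ‖ψ (x + z) - ψ x‖ₑ ^ 2 := by
          rw [lintegral_const_mul' _ _ (ENNReal.inv_ne_top.2 hv0),
            lintegral_lintegral_swap hmeas.aemeasurable]
      _ ≤ vδ⁻¹ * ∫⁻ z in Metric.ball (0 : V) (2 * δ), ENNReal.ofReal (C * (2 * δ) ^ 2) := by
          have hC0 : 0 ≤ C := (integral_nonneg fun x => sq_nonneg (ψ x)).trans hC
          gcongr vδ⁻¹ * ?_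
          refine setLIntegral_mono' Metric.isOpen_ball.measurableSet fun z hz => (hT z).trans ?_
          rw [mem_ball_zero_iff] at hz
          gcongr
      _ = ENNReal.ofReal (2 ^ Module.finrank ℝ V * (C * (2 * δ) ^ 2)) := by
          rw [setLIntegral_const, Measure.addHaar_ball_mul_of_pos volume (0 : V) two_pos, ← hvδ,
            ENNReal.ofReal_mul (p := 2 ^ Module.finrank ℝ V) (by positivity), mul_left_comm,
            mul_left_comm vδ⁻¹, ENNReal.inv_mul_cancel hv0 hv, mul_one, mul_comm]
      _ ≤ ENNReal.ofReal ε := ENNReal.ofReal_le_ofReal hδε.le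

end Rellich

/-! ### Growth of the exponent and uniform smallness of tails -/

section Tail

variable {n : ℕ} {h v : E n → ℝ}

lemma fderiv_gradient (u : E n → ℝ) (x : E n) :
    fderiv ℝ u x (gradient u x) = ‖gradient u x‖ ^ 2 := by
  rw [← inner_gradient_left, real_inner_self_eq_norm_sq]

lemma norm_gradient_sq (u : E n → ℝ) (x : E n) :
    ‖gradient u x‖ ^ 2 = ∑ i, fderiv ℝ u x (basisVec i) ^ 2 := by
  rw [← (EuclideanSpace.basisFun (Fin n) ℝ).sum_sq_norm_inner_right (gradient u x)]
  refine Finset.sum_congr rfl fun i _ => ?_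
  rw [EuclideanSpace.basisFun_apply, real_inner_comm, inner_gradient_left, Real.norm_eq_abs, sq_abs]

lemma lap_exp_neg (hh : ContDiff ℝ 2 h) (x : E n) :
    lap (fun x => Real.exp (-(2 * h x))) x =
      Real.exp (-(2 * h x)) * (4 * ‖gradient h x‖ ^ 2 - 2 * lap h x) := by
  have hd : ∀ x, HasFDerivAt h (fderiv ℝ h x) x := fun x =>
    ((hh.differentiable two_ne_zero) x).hasFDerivAt
  have h1 : ∀ x, HasFDerivAt (fun x => Real.exp (-(2 * h x)))
      (Real.exp (-(2 * h x)) • (-2 : ℝ) • fderiv ℝ h x) x := fun x => by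
    simpa only [neg_mul] using ((hd x).const_mul (-2)).exp
  have h2 : ∀ (i : Fin n), HasFDerivAt
      (fun y => fderiv ℝ (fun x => Real.exp (-(2 * h x))) y (basisVec i))
      (Real.exp (-(2 * h x)) • (-2 : ℝ) • fderiv ℝ (fun y => fderiv ℝ h y (basisVec i)) x +
        ((-2 : ℝ) * fderiv ℝ h x (basisVec i)) • Real.exp (-(2 * h x)) • (-2 : ℝ) • fderiv ℝ h x)
      x := by
    intro i
    have e1 : (fun y => fderiv ℝ (fun x => Real.exp (-(2 * h x))) y (basisVec i)) =
        fun y => Real.exp (-(2 * h y)) * (-2 * fderiv ℝ h y (basisVec i)) := by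
      ext y
      rw [(h1 y).fderiv]
      simp
    rw [e1]
    exact (h1 x).mul ((((contDiff_fderiv_apply hh (basisVec i)).differentiable
      one_ne_zero) x).hasFDerivAt.const_mul (-2))
  unfold lap
  simp only [(h2 _).fderiv, norm_gradient_sq, Finset.mul_sum, ← Finset.sum_sub_distrib]
  refine Finset.sum_congr rfl fun i _ => ?_
  simp
  ring

/-- The exponent of an integrable density grows at infinity if `|∇h|² - Δh` is nonnegative
there. -/
lemma tendsto_exponent (hh : ContDiff ℝ 2 h) (hint : Integrable fun x => Real.exp (-(2 * h x)))
    (hP : ∀ᶠ x in cocompact (E n), 0 ≤ -lap h x + ‖gradient h x‖ ^ 2) :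
    Tendsto h (cocompact (E n)) atTop := by
  have h1 : Tendsto (fun x => Real.exp (-(2 * h x))) (cocompact (E n)) (𝓝 0) := by
    refine tendsto_zero_of_lap_nonneg (by fun_prop) (fun x => (Real.exp_pos _).le) hint ?_
    filter_upwards [hP] with x hx
    rw [lap_exp_neg hh]
    exact mul_nonneg (Real.exp_pos _).le (by nlinarith [sq_nonneg ‖gradient h x‖])
  have h2 := tendsto_neg_atBot_atTop.comp (Real.tendsto_exp_comp_nhds_zero.1 h1)
  have h3 := h2.const_mul_atTop (show (0 : ℝ) < 1 / 2 by norm_num)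
  refine h3.congr fun x => ?_
  simp only [Function.comp_apply]
  ring

/-- The potential that the form dominates. -/
def potential (h v : E n → ℝ) (x : E n) : ℝ :=
  Real.exp (v x) ^ 2 / 2 *
    (-lap h x + 3 / 2 * ‖gradient h x‖ ^ 2 - 2 * fderiv ℝ v x (gradient h x))

lemma continuous_potential (hh : ContDiff ℝ 2 h) (hv : ContDiff ℝ 2 v) :
    Continuous (potential h v) := by
  have h1 := continuous_gradient (hh.of_le (by norm_num : (1 : WithTop ℕ∞) ≤ 2))
  have h2 := continuous_lap hh
  have h3 := (hv.continuous_fderiv two_ne_zero).clm_apply h1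
  have h4 := hv.continuous
  unfold potential
  fun_prop

/-- Where `|∇v| ≤ |∇h| / 4`, the term `2 ∇v·∇h` costs at most `½ |∇h|²`; of the `3/2` there remains
exactly the `|∇h|²` of the hypothesis. -/
lemma tendsto_potential
    (ha_ne : ∀ᶠ x in cocompact (E n), gradient h x ≠ 0)
    (ha : Tendsto (fun x => ‖gradient v x‖ / ‖gradient h x‖) (cocompact (E n)) (𝓝 0))
    (hb : Tendsto (fun x => Real.exp (v x) ^ 2 * (-lap h x + ‖gradient h x‖ ^ 2))
      (cocompact (E n)) atTop) :
    Tendsto (potential h v) (cocompact (E n)) atTop := by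
  refine tendsto_atTop_mono' _ ?_ (hb.const_mul_atTop (show (0 : ℝ) < 1 / 2 by norm_num))
  filter_upwards [ha_ne, ha.eventually (gt_mem_nhds (show (0 : ℝ) < 1 / 4 by norm_num))]
    with x hx1 hx2
  rw [div_lt_iff₀ (norm_pos_iff.2 hx1)] at hx2
  have h1 : fderiv ℝ v x (gradient h x) ≤ ‖gradient v x‖ * ‖gradient h x‖ := by
    rw [← inner_gradient_left]
    exact real_inner_le_norm _ _
  have h2 := mul_le_mul_of_nonneg_right hx2.le (norm_nonneg (gradient h x))
  have h3 : 0 ≤ Real.exp (v x) ^ 2 := sq_nonneg _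
  unfold potential
  nlinarith

/-- The form dominates the potential on functions cut off along level sets of `h`. -/
lemma integral_potential_le (hh : ContDiff ℝ 2 h) (hv : ContDiff ℝ 2 v)
    (hlim : Tendsto h (cocompact (E n)) atTop) {φ : E n → ℝ} {g : E n → E n}
    (hφ : LocalSobolev φ g)
    (hgi : Integrable fun x => Real.exp (v x) ^ 2 * ‖g x‖ ^ 2 * Real.exp (-(2 * h x))) (k : ℝ) :
    Integrable (fun x => φ x ^ 2 *
      (Real.smoothTransition (k - h x) * Real.exp (-(2 * h x)) * potential h v x)) ∧
    ∫ x, φ x ^ 2 * (Real.smoothTransition (k - h x) * Real.exp (-(2 * h x)) * potential h v x) ≤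
      ∫ x, Real.exp (v x) ^ 2 * ‖g x‖ ^ 2 * Real.exp (-(2 * h x)) := by
  have hh1 : ContDiff ℝ 1 h := hh.of_le (by norm_num)
  have hv1 : ContDiff ℝ 1 v := hv.of_le (by norm_num)
  have hχ : ContDiff ℝ 1 fun x => Real.smoothTransition (k - h x) :=
    Real.smoothTransition.contDiff.comp (contDiff_const.sub hh1)
  have hχc : HasCompactSupport fun x => Real.smoothTransition (k - h x) := by
    obtain ⟨K, hK, hKh⟩ := mem_cocompact.1 (hlim.eventually (eventually_ge_atTop k))
    refine HasCompactSupport.intro hK fun x hx => ?_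
    exact Real.smoothTransition.zero_of_nonpos (sub_nonpos.2 (hKh hx))
  have hexp : ContDiff ℝ 1 fun x => Real.exp (2 * v x - 2 * h x) :=
    ((contDiff_const.mul hv1).sub (contDiff_const.mul hh1)).exp
  set ω : E n → ℝ := fun x => Real.smoothTransition (k - h x) * Real.exp (2 * v x - 2 * h x)
    with hωdef
  have hω : ContDiff ℝ 1 ω := hχ.mul hexp
  have hωc : HasCompactSupport ω := hχc.mul_right
  have hωpos : ∀ x, 0 ≤ ω x := fun x =>
    mul_nonneg (Real.smoothTransition.nonneg _) (Real.exp_pos _).le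
  have hsplit : ∀ x, Real.exp (2 * v x - 2 * h x) = Real.exp (v x) ^ 2 * Real.exp (-(2 * h x)) := by
    intro x
    rw [← Real.exp_nat_mul, ← Real.exp_add]
    congr 1
  -- Differentiating the cutoff gives `-deriv smoothTransition (k - h) |∇h|²` times a positive
  -- factor; this is nonpositive and is dropped.
  have hdω : ∀ x, fderiv ℝ ω x (gradient h x) ≤
      ω x * (2 * fderiv ℝ v x (gradient h x) - 2 * ‖gradient h x‖ ^ 2) := by
    intro x
    have dh := ((hh1.differentiable one_ne_zero) x).hasFDerivAt
    have dv := ((hv1.differentiable one_ne_zero) x).hasFDerivAt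
    have d1 : HasFDerivAt (fun x => Real.smoothTransition (k - h x))
        (deriv Real.smoothTransition (k - h x) • -fderiv ℝ h x) x :=
      HasDerivAt.comp_hasFDerivAt (h₂ := Real.smoothTransition) x
        ((Real.smoothTransition.contDiff (n := 1)).differentiable one_ne_zero
          (k - h x)).hasDerivAt (dh.const_sub k)
    have d2 : HasFDerivAt (fun x => Real.exp (2 * v x - 2 * h x))
        (Real.exp (2 * v x - 2 * h x) • ((2 : ℝ) • fderiv ℝ v x - (2 : ℝ) • fderiv ℝ h x)) x :=
      ((dv.const_mul 2).sub (dh.const_mul 2)).exp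
    have d : HasFDerivAt ω _ x := d1.mul d2
    have d3 : 0 ≤ deriv Real.smoothTransition (k - h x) :=
      Real.smoothTransition.monotone.deriv_nonneg
    rw [d.fderiv]
    have h4 := mul_nonneg (mul_nonneg d3 (sq_nonneg ‖gradient h x‖))
      (Real.exp_pos (2 * v x - 2 * h x)).le
    simp only [hωdef, add_apply, smul_apply,
      sub_apply, _root_.neg_apply, smul_eq_mul, fderiv_gradient]
    nlinarith
  have hcont : Continuous fun x =>
      Real.smoothTransition (k - h x) * Real.exp (-(2 * h x)) * potential h v x :=
    (hχ.continuous.mul (by have := hh.continuous; fun_prop)).mul (continuous_potential hh hv)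
  have hi := hφ.integrable_sq_mul hcont (hχc.mul_right.mul_right)
  refine ⟨hi, ?_⟩
  have hcont' : Continuous fun x => -(fderiv ℝ ω x (gradient h x) + ω x * lap h x) / 2 -
        ω x * ‖gradient h x‖ ^ 2 / 4 := by
    have h1 := continuous_gradient hh1
    have h2 := continuous_lap hh
    have h3 := (hω.continuous_fderiv one_ne_zero).clm_apply h1
    have h4 := hω.continuous
    fun_prop
  have hcc' : HasCompactSupport fun x => -(fderiv ℝ ω x (gradient h x) + ω x * lap h x) / 2 -
        ω x * ‖gradient h x‖ ^ 2 / 4 :=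
    HasCompactSupport.intro hωc fun x hx => by
      rw [fderiv_of_notMem_tsupport ℝ hx, image_eq_zero_of_notMem_tsupport hx]
      simp
  calc ∫ x, φ x ^ 2 *
        (Real.smoothTransition (k - h x) * Real.exp (-(2 * h x)) * potential h v x)
      ≤ ∫ x, φ x ^ 2 * (-(fderiv ℝ ω x (gradient h x) + ω x * lap h x) / 2 -
        ω x * ‖gradient h x‖ ^ 2 / 4) := by
        refine integral_mono hi (hφ.integrable_sq_mul hcont' hcc') fun x => ?_
        refine mul_le_mul_of_nonneg_left ?_ (sq_nonneg _)
        have e1 : Real.smoothTransition (k - h x) * Real.exp (-(2 * h x)) * potential h v x =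
            ω x * (-lap h x + 3 / 2 * ‖gradient h x‖ ^ 2 -
              2 * fderiv ℝ v x (gradient h x)) / 2 := by
          simp only [hωdef, hsplit, potential]
          ring
        rw [e1]
        linarith [hdω x]
    _ ≤ ∫ x, ‖g x‖ ^ 2 * ω x := hφ.hardy hω hωc hωpos hh
    _ ≤ _ := by
        refine integral_mono (hφ.integrable_sq_grad_mul hω.continuous hωc) hgi fun x => ?_
        simp only [hωdef, hsplit]
        have h1 : 0 ≤ Real.exp (v x) ^ 2 * ‖g x‖ ^ 2 * Real.exp (-(2 * h x)) := by positivity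
        nlinarith [mul_le_mul_of_nonneg_right (Real.smoothTransition.le_one (k - h x)) h1]

/-- Mass does not escape to infinity on sets of bounded energy. -/
theorem exists_tail_le (hh : ContDiff ℝ 2 h) (hv : ContDiff ℝ 2 v)
    (hlim : Tendsto h (cocompact (E n)) atTop)
    (hW : Tendsto (potential h v) (cocompact (E n)) atTop) {C D ε : ℝ} (hC : 0 ≤ C) (hD : 0 ≤ D)
    (hε : 0 < ε) :
    ∃ R : ℝ, ∀ (φ : E n → ℝ) (g : E n → E n), LocalSobolev φ g →
      (Integrable fun x => φ x ^ 2 * Real.exp (-(2 * h x))) →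
      (Integrable fun x => Real.exp (v x) ^ 2 * ‖g x‖ ^ 2 * Real.exp (-(2 * h x))) →
      ∫ x, φ x ^ 2 * Real.exp (-(2 * h x)) ≤ D →
      ∫ x, Real.exp (v x) ^ 2 * ‖g x‖ ^ 2 * Real.exp (-(2 * h x)) ≤ C →
      ∫ x in (Metric.closedBall 0 R)ᶜ, φ x ^ 2 * Real.exp (-(2 * h x)) ≤ ε := by
  obtain ⟨M, hM0, hM⟩ : ∃ M : ℝ, 0 ≤ M ∧ ∀ x, -M ≤ potential h v x := by
    obtain ⟨K, hK, hK'⟩ := mem_cocompact.1 (hW.eventually (eventually_ge_atTop 0))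
    obtain ⟨M, hM⟩ := hK.exists_bound_of_continuousOn (continuous_potential hh hv).continuousOn
    refine ⟨max M 0, le_max_right _ _, fun x => ?_⟩
    by_cases hx : x ∈ K
    · linarith [(abs_le.1 (hM x hx)).1, le_max_left M 0]
    · have : 0 ≤ potential h v x := hK' hx
      linarith [le_max_right M 0]
  -- With this choice `N ε = C + M D + ε`, which exceeds the bound on `N` times the tail mass.
  set N : ℝ := (C + M * D) / ε + 1 with hN
  have hN0 : 0 < N := by positivity
  obtain ⟨R, hR⟩ : ∃ R : ℝ, ∀ x ∉ Metric.closedBall (0 : E n) R, N ≤ potential h v x := by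
    obtain ⟨K, hK, hK'⟩ := mem_cocompact.1 (hW.eventually (eventually_ge_atTop N))
    obtain ⟨R, hR⟩ := hK.isBounded.subset_closedBall (0 : E n)
    exact ⟨R, fun x hx => hK' fun h => hx (hR h)⟩
  refine ⟨R, fun φ g hφ hφi hgi hφD hgC => ?_⟩
  set F : E n → ℝ := fun x => φ x ^ 2 * Real.exp (-(2 * h x)) with hF
  have hF0 : ∀ x, 0 ≤ F x := fun x => by positivity
  let A : ℕ → Set (E n) := fun m => Metric.closedBall 0 m \ Metric.closedBall 0 R
  have hA : ∀ m, MeasurableSet (A m) := fun m =>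
    Metric.isClosed_closedBall.measurableSet.diff Metric.isClosed_closedBall.measurableSet
  have hU : ⋃ m, A m = (Metric.closedBall (0 : E n) R)ᶜ := by
    ext x
    obtain ⟨m, hm⟩ := exists_nat_ge ‖x‖
    simp only [A, Set.mem_iUnion, Set.mem_sdiff, Set.mem_compl_iff]
    exact ⟨fun ⟨_, h⟩ => h.2, fun h => ⟨m, mem_closedBall_zero_iff.2 hm, h⟩⟩
  have hlimA := tendsto_setIntegral_of_monotone (μ := volume) (f := F) hA
    (fun a b hab => Set.sdiff_subset_sdiff_left (Metric.closedBall_subset_closedBall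
      (Nat.cast_le.2 hab))) hφi.integrableOn
  rw [hU] at hlimA
  refine le_of_tendsto hlimA (Eventually.of_forall fun m => ?_)
  -- On the bounded shell `A m` one has `h ≤ b`, so the cutoff at level `b + 1` equals `1` there.
  -- The final bound does not depend on `m`.
  obtain ⟨b, hb⟩ := (isCompact_closedBall (0 : E n) m).exists_bound_of_continuousOn
    hh.continuous.continuousOn
  obtain ⟨hi, hle⟩ := integral_potential_le hh hv hlim hφ hgi (b + 1)
  have h1 : ∫ x, (N * (A m).indicator F x - M * F x) ≤ ∫ x, φ x ^ 2 *
      (Real.smoothTransition (b + 1 - h x) * Real.exp (-(2 * h x)) * potential h v x) := by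
    refine integral_mono (((hφi.indicator (hA m)).const_mul N).sub (hφi.const_mul M)) hi
      fun x => ?_
    have e1 : φ x ^ 2 *
        (Real.smoothTransition (b + 1 - h x) * Real.exp (-(2 * h x)) * potential h v x) =
        F x * (Real.smoothTransition (b + 1 - h x) * potential h v x) := by
      simp only [hF]; ring
    simp only
    rw [e1]
    by_cases hx : x ∈ A m
    · rw [Set.indicator_of_mem hx, Real.smoothTransition.one_of_one_le
        (by linarith [(abs_le.1 (hb x hx.1)).2]), one_mul]
      nlinarith [hR x hx.2, hF0 x, mul_nonneg hM0 (hF0 x),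
        mul_le_mul_of_nonneg_left (hR x hx.2) (hF0 x)]
    · rw [Set.indicator_of_notMem hx]
      have h2 := Real.smoothTransition.nonneg (b + 1 - h x)
      have h3 := Real.smoothTransition.le_one (b + 1 - h x)
      have h4 : -M ≤ Real.smoothTransition (b + 1 - h x) * potential h v x := by
        nlinarith [hM x, mul_le_mul_of_nonneg_left (hM x) h2, mul_le_mul_of_nonneg_right h3 hM0]
      nlinarith [mul_le_mul_of_nonneg_left h4 (hF0 x)]
  rw [integral_sub ((hφi.indicator (hA m)).const_mul N) (hφi.const_mul M), integral_const_mul,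
    integral_const_mul, integral_indicator (hA m)] at h1
  have h5 : M * ∫ x, F x ≤ M * D := mul_le_mul_of_nonneg_left hφD hM0
  have h6 : N * ∫ x in A m, F x ≤ N * ε := by
    have : N * ε = C + M * D + ε := by rw [hN]; field_simp
    linarith
  exact le_of_mul_le_mul_left h6 hN0

end Tail

/-! ### Energy bounds, transfer to Lebesgue measure and total boundedness -/

section Assembly

variable {n : ℕ}

lemma mul_norm_sq_le_quad {A : Matrix (Fin n) (Fin n) ℝ} {a : ℝ}
    (hA : a • (1 : Matrix (Fin n) (Fin n) ℝ) ≤ A) (w : E n) : a * ‖w‖ ^ 2 ≤ quad A w w := by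
  have h := (Matrix.le_iff.1 hA).dotProduct_mulVec_nonneg w.ofLp
  rw [Matrix.sub_mulVec, dotProduct_sub, Matrix.smul_mulVec, Matrix.one_mulVec,
    dotProduct_smul] at h
  have h2 : star w.ofLp ⬝ᵥ w.ofLp = ‖w‖ ^ 2 := by
    rw [EuclideanSpace.real_norm_sq_eq]
    simp [dotProduct, sq]
  rw [h2] at h
  simpa [quad] using h

variable {q : E n → ℝ}

lemma integrable_popMeasure_iff (hq : Continuous q) (hpos : ∀ x, 0 < q x) (f : E n → ℝ) :
    Integrable f (popMeasure q) ↔ Integrable fun x => f x * q x := by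
  rw [popMeasure, integrable_withDensity_iff_integrable_smul'
    hq.measurable.ennreal_ofReal (ae_of_all _ fun x => ENNReal.ofReal_lt_top)]
  simp only [ENNReal.toReal_ofReal (hpos _).le, smul_eq_mul, mul_comm]

lemma integral_popMeasure (hq : Continuous q) (hpos : ∀ x, 0 < q x) (f : E n → ℝ) :
    ∫ x, f x ∂(popMeasure q) = ∫ x, f x * q x := by
  rw [popMeasure, integral_withDensity_eq_integral_toReal_smul
    hq.measurable.ennreal_ofReal (ae_of_all _ fun x => ENNReal.ofReal_lt_top)]
  simp only [ENNReal.toReal_ofReal (hpos _).le, smul_eq_mul, mul_comm]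

lemma norm_sq_eq_integral (hq : Continuous q) (hpos : ∀ x, 0 < q x) {f : L2 q} {f' : E n → ℝ}
    (hf : f =ᵐ[popMeasure q] f') : ‖f‖ ^ 2 = ∫ x, f' x ^ 2 * q x := by
  rw [← real_inner_self_eq_norm_sq, L2.inner_def, ← integral_popMeasure hq hpos]
  refine integral_congr_ae ?_
  filter_upwards [hf] with x hx
  simp [hx, sq]

lemma locallyIntegrable_of_mul {f w : E n → ℝ} (hw : Continuous w) (hpos : ∀ x, 0 < w x)
    (hf : Integrable fun x => f x * w x) : LocallyIntegrable f := by
  have h := (locallyIntegrableOn_univ.2 hf.locallyIntegrable).continuousOn_mul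
    (hw.inv₀ fun x => (hpos x).ne').continuousOn isOpen_univ.isLocallyClosed
  rw [locallyIntegrableOn_univ] at h
  refine h.congr (ae_of_all _ fun x => ?_)
  have := (hpos x).ne'
  simp only [Pi.inv_apply]
  field_simp

/-- The elements of the constraint set have bounded energy. -/
lemma exists_localSobolev {S : E n → Matrix (Fin n) (Fin n) ℝ} {v : E n → ℝ}
    (hq : Continuous q) (hpos : ∀ x, 0 < q x) (hv : Continuous v)
    (hS : ∀ x, Real.exp (v x) ^ 2 • (1 : Matrix (Fin n) (Fin n) ℝ) ≤ S x) {θ : ℝ} (hθ : 0 < θ)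
    {φ : L2 q} (hφ : φ ∈ constraintSet q S θ) :
    ∃ g : E n → E n, LocalSobolev φ g ∧ (Integrable fun x => φ x ^ 2 * q x) ∧
      (Integrable fun x => Real.exp (v x) ^ 2 * ‖g x‖ ^ 2 * q x) ∧
      ∫ x, φ x ^ 2 * q x ≤ 1 / θ ∧
      ∫ x, Real.exp (v x) ^ 2 * ‖g x‖ ^ 2 * q x ≤ 2 := by
  obtain ⟨hdom, hle⟩ := hφ
  have hgrad : IsWeakGradient q S φ (weakGrad q S φ) := by
    have hex : ∃ g, IsWeakGradient q S φ g := hdom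
    rw [weakGrad, dif_pos hex]
    exact hex.choose_spec
  unfold form at hle
  set g := weakGrad q S φ
  have hquad : ∀ x, Real.exp (v x) ^ 2 * ‖g x‖ ^ 2 ≤ quad (S x) (g x) (g x) := fun x =>
    mul_norm_sq_le_quad (hS x) (g x)
  have hφi : Integrable fun x => φ x ^ 2 * q x :=
    (integrable_popMeasure_iff hq hpos _).1 (Lp.memLp φ).integrable_sq
  have hqi := (integrable_popMeasure_iff hq hpos _).1 hgrad.finite_energy
  have hgi : Integrable fun x => Real.exp (v x) ^ 2 * ‖g x‖ ^ 2 * q x := by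
    refine hqi.mono ?_ (ae_of_all _ fun x => ?_)
    · have := hgrad.measurable
      have := hv.measurable
      have := hq.measurable
      exact Measurable.aestronglyMeasurable (by fun_prop)
    · rw [Real.norm_of_nonneg (mul_nonneg (by positivity) (hpos x).le)]
      exact (mul_le_mul_of_nonneg_right (hquad x) (hpos x).le).trans (le_abs_self _)
  have h1 : ∫ x, Real.exp (v x) ^ 2 * ‖g x‖ ^ 2 * q x ≤
      ∫ x, quad (S x) (g x) (g x) ∂(popMeasure q) := by
    rw [integral_popMeasure hq hpos]
    exact integral_mono hgi hqi fun x => mul_le_mul_of_nonneg_right (hquad x) (hpos x).le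
  have h2 : 0 ≤ ∫ x, Real.exp (v x) ^ 2 * ‖g x‖ ^ 2 * q x :=
    integral_nonneg fun x => mul_nonneg (by positivity) (hpos x).le
  have h3 : 0 ≤ ∫ x, φ x ^ 2 * q x :=
    integral_nonneg fun x => mul_nonneg (sq_nonneg _) (hpos x).le
  -- Both terms of the constraint are nonnegative, so each is at most `1`; the factor `1 / 2` in the
  -- form yields the energy bound `2`.
  rw [real_inner_self_eq_norm_sq, norm_sq_eq_integral hq hpos (ae_eq_refl _)] at hle
  refine ⟨g, ⟨(Lp.stronglyMeasurable φ).measurable, hgrad.measurable,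
    locallyIntegrable_of_mul hq hpos hφi, ?_, hgrad.integral_eq⟩, hφi, hgi, ?_, ?_⟩
  · refine locallyIntegrable_of_mul (w := fun x => Real.exp (v x) ^ 2 * q x) (by fun_prop)
      (fun x => mul_pos (by positivity) (hpos x)) (hgi.congr (ae_of_all _ fun x => ?_))
    simp only
    ring
  · rw [le_div_iff₀ hθ]
    linarith
  · nlinarith

/-- This converts weighted bounds into Lebesgue bounds for functions that have been cut off. -/
lemma exists_le_mul {f w : E n → ℝ} (hf : Continuous f) (hc : HasCompactSupport f)
    (hw : Continuous w) (hpos : ∀ x, 0 < w x) : ∃ a : ℝ, ∀ x, f x ≤ a * w x := by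
  obtain ⟨a, ha⟩ := (hc.mul_right (f' := fun x => (w x)⁻¹)).exists_bound_of_continuous
    (hf.mul (hw.inv₀ fun x => (hpos x).ne'))
  refine ⟨a, fun x => ?_⟩
  have h := (le_abs_self _).trans (ha x)
  simp only [Pi.mul_apply] at h
  rwa [← div_eq_mul_inv, div_le_iff₀ (hpos x)] at h

lemma enorm_sq_eq (r : ℝ) : ‖r‖ₑ ^ 2 = ENNReal.ofReal (r ^ 2) := by
  rw [← enorm_pow, Real.enorm_of_nonneg (sq_nonneg r)]

lemma lintegral_sq_le_of_eLpNorm_le {f g : E n → ℝ} (hg : MemLp g 2 volume)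
    (h : eLpNorm f 2 volume ≤ eLpNorm g 2 volume) :
    ∫⁻ x, ‖f x‖ₑ ^ 2 ≤ ENNReal.ofReal (∫ x, g x ^ 2) := by
  have hn : ∀ u : E n → ℝ, eLpNorm u 2 volume ^ 2 = ∫⁻ x, ‖u x‖ₑ ^ 2 := fun u => by
    simpa using eLpNorm_nnreal_pow_eq_lintegral (p := 2) (f := u) (μ := volume) two_ne_zero
  rw [ofReal_integral_eq_lintegral_ofReal hg.integrable_sq (ae_of_all _ fun x => sq_nonneg _)]
  simp only [← enorm_sq_eq]
  rw [← hn, ← hn]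
  gcongr

/-- Uniform bounds for functions of bounded energy after a smooth cutoff. -/
lemma exists_cutoff_bound {v ζ : E n → ℝ} (hq : Continuous q) (hpos : ∀ x, 0 < q x)
    (hv : Continuous v) (hζ : ContDiff ℝ 1 ζ) (hc : HasCompactSupport ζ) (D G : ℝ) :
    ∃ C : ℝ, ∀ (φ : E n → ℝ) (g : E n → E n), LocalSobolev φ g →
      (Integrable fun x => φ x ^ 2 * q x) →
      (Integrable fun x => Real.exp (v x) ^ 2 * ‖g x‖ ^ 2 * q x) →
      ∫ x, φ x ^ 2 * q x ≤ D → ∫ x, Real.exp (v x) ^ 2 * ‖g x‖ ^ 2 * q x ≤ G →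
      ∫ x, (ζ x * φ x) ^ 2 ≤ C ∧ ∀ z, ∫⁻ x, ‖ζ (x + z) * φ (x + z) - ζ x * φ x‖ₑ ^ 2 ≤
        ENNReal.ofReal (C * ‖z‖ ^ 2) := by
  have hcζ : HasCompactSupport fun x => ζ x ^ 2 :=
    hc.comp_left (g := fun t : ℝ => t ^ 2) (by norm_num)
  have hcd : HasCompactSupport fun x => ‖fderiv ℝ ζ x‖ ^ 2 :=
    (hc.fderiv ℝ).comp_left (g := fun L => ‖L‖ ^ 2) (by norm_num)
  have hdc : Continuous fun x => ‖fderiv ℝ ζ x‖ ^ 2 :=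
    (hζ.continuous_fderiv one_ne_zero).norm.pow 2
  obtain ⟨a₁, ha₁⟩ := exists_le_mul (hζ.continuous.pow 2) hcζ hq hpos
  obtain ⟨a₂, ha₂⟩ := exists_le_mul (hζ.continuous.pow 2) hcζ
    (w := fun x => Real.exp (v x) ^ 2 * q x) (by fun_prop)
    (fun x => mul_pos (by positivity) (hpos x))
  obtain ⟨a₃, ha₃⟩ := exists_le_mul hdc hcd hq hpos
  simp only [Pi.pow_apply] at ha₁ ha₂
  have ha₁' : 0 ≤ a₁ := nonneg_of_mul_nonneg_left ((sq_nonneg (ζ 0)).trans (ha₁ 0)) (hpos 0)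
  have ha₂' : 0 ≤ a₂ := nonneg_of_mul_nonneg_left ((sq_nonneg (ζ 0)).trans (ha₂ 0))
    (mul_pos (by positivity) (hpos 0))
  have ha₃' : 0 ≤ a₃ := nonneg_of_mul_nonneg_left ((sq_nonneg _).trans (ha₃ 0)) (hpos 0)
  -- The first entry bounds the `L²` norm; the second bounds the directional derivative of `ζ φ`
  -- through `(a + b)² ≤ 2 a² + 2 b²`.
  refine ⟨max (a₁ * D) (2 * (a₂ * G + a₃ * D)), fun φ g hφ hφi hgi hD hG => ⟨?_, fun z => ?_⟩⟩
  · refine le_trans ?_ ((mul_le_mul_of_nonneg_left hD ha₁').trans (le_max_left _ _))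
    rw [← integral_const_mul]
    refine integral_mono (hφ.memLp_mul hζ.continuous hc).integrable_sq (hφi.const_mul a₁)
      fun x => ?_
    simp only
    nlinarith [mul_le_mul_of_nonneg_right (ha₁ x) (sq_nonneg (φ x))]
  · have hL := hφ.memLp_deriv_mul z hζ hc
    refine (lintegral_sq_le_of_eLpNorm_le hL ((hφ.hasWeakDeriv_mul z hζ hc).eLpNorm_translate_sub_le
      (hφ.memLp_mul hζ.continuous hc) hL)).trans (ENNReal.ofReal_le_ofReal ?_)
    calc ∫ x, (ζ x * inner ℝ (g x) z + φ x * fderiv ℝ ζ x z) ^ 2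
        ≤ ∫ x, 2 * ‖z‖ ^ 2 * (a₂ * (Real.exp (v x) ^ 2 * ‖g x‖ ^ 2 * q x) +
            a₃ * (φ x ^ 2 * q x)) := by
          refine integral_mono hL.integrable_sq
            (((hgi.const_mul a₂).add (hφi.const_mul a₃)).const_mul _) fun x => ?_
          have h1 : (inner ℝ (g x) z) ^ 2 ≤ (‖g x‖ * ‖z‖) ^ 2 :=
            sq_le_sq.2 ((abs_real_inner_le_norm _ _).trans (le_abs_self _))
          have h2 : (fderiv ℝ ζ x z) ^ 2 ≤ (‖fderiv ℝ ζ x‖ * ‖z‖) ^ 2 :=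
            sq_le_sq.2 (((fderiv ℝ ζ x).le_opNorm z).trans (le_abs_self _))
          have h3 := mul_le_mul_of_nonneg_left h1 (sq_nonneg (ζ x))
          have h4 := mul_le_mul_of_nonneg_left h2 (sq_nonneg (φ x))
          have h5 := mul_le_mul_of_nonneg_right (ha₂ x) (sq_nonneg (‖g x‖ * ‖z‖))
          have h6 := mul_le_mul_of_nonneg_right (ha₃ x) (sq_nonneg (φ x * ‖z‖))
          simp only
          nlinarith [sq_nonneg (ζ x * inner ℝ (g x) z - φ x * fderiv ℝ ζ x z)]
      _ = 2 * ‖z‖ ^ 2 * (a₂ * (∫ x, Real.exp (v x) ^ 2 * ‖g x‖ ^ 2 * q x) +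
            a₃ * ∫ x, φ x ^ 2 * q x) := by
          rw [integral_const_mul, integral_add (hgi.const_mul a₂) (hφi.const_mul a₃),
            integral_const_mul, integral_const_mul]
      _ ≤ 2 * ‖z‖ ^ 2 * (a₂ * G + a₃ * D) := by gcongr
      _ ≤ max (a₁ * D) (2 * (a₂ * G + a₃ * D)) * ‖z‖ ^ 2 := by
          rw [mul_right_comm]
          exact mul_le_mul_of_nonneg_right (le_max_right _ _) (sq_nonneg _)

lemma memLp_step [IsFiniteMeasure (popMeasure q)] {K : Set (E n)} (hK : MeasurableSet K)
    {m : ℕ} {p : E n → Fin m} (hp : Measurable p) (c : Fin m → ℝ) :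
    MemLp (fun x => K.indicator (fun _ => (1 : ℝ)) x * c (p x)) 2 (popMeasure q) := by
  refine MemLp.of_bound (C := ‖c‖) ?_ (ae_of_all _ fun x => ?_)
  · exact ((measurable_const.indicator hK).mul
      ((Measurable.of_discrete (f := c)).comp hp)).aestronglyMeasurable
  · rw [norm_mul]
    have h1 : ‖K.indicator (fun _ => (1 : ℝ)) x‖ ≤ 1 := by
      by_cases hx : x ∈ K <;> simp [hx]
    exact (mul_le_of_le_one_left (norm_nonneg _) h1).trans (norm_le_pi_norm c _)

/-- The step functions with given level sets, cut off to `K`, as elements of `L²`. -/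
def stepLp (q : E n → ℝ) [IsFiniteMeasure (popMeasure q)] {K : Set (E n)} (hK : MeasurableSet K)
    {m : ℕ} {p : E n → Fin m} (hp : Measurable p) : (Fin m → ℝ) →ₗ[ℝ] L2 q where
  toFun c := (memLp_step hK hp c).toLp _
  map_add' c d := by
    rw [← MemLp.toLp_add]
    exact MemLp.toLp_congr _ _ (ae_of_all _ fun x => by simp [mul_add])
  map_smul' a c := by
    rw [RingHom.id_apply, ← MemLp.toLp_const_smul]
    exact MemLp.toLp_congr _ _ (ae_of_all _ fun x => by simp; ring)

lemma coeFn_stepLp (q : E n → ℝ) [IsFiniteMeasure (popMeasure q)] {K : Set (E n)}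
    (hK : MeasurableSet K) {m : ℕ} {p : E n → Fin m} (hp : Measurable p) (c : Fin m → ℝ) :
    stepLp q hK hp c =ᵐ[popMeasure q] fun x => K.indicator (fun _ => (1 : ℝ)) x * c (p x) :=
  (memLp_step hK hp c).coeFn_toLp

/-- Every element lies within `ε / 2` of the image of one closed ball under the linear map `stepLp`.
That image is compact, so a finite `ε / 2`-net of it is an `ε`-net of the constraint set. -/
theorem totallyBounded_constraintSet {S : E n → Matrix (Fin n) (Fin n) ℝ} {h v : E n → ℝ}
    (hqh : ∀ x, q x = Real.exp (-(2 * h x))) (hqi : Integrable q) (hh : ContDiff ℝ 2 h)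
    (hv : ContDiff ℝ 2 v)
    (hS : ∀ x, Real.exp (v x) ^ 2 • (1 : Matrix (Fin n) (Fin n) ℝ) ≤ S x)
    (hlim : Tendsto h (cocompact (E n)) atTop)
    (hW : Tendsto (potential h v) (cocompact (E n)) atTop) {θ : ℝ} (hθ : 0 < θ) :
    TotallyBounded (constraintSet q S θ) := by
  have hpos : ∀ x, 0 < q x := fun x => hqh x ▸ Real.exp_pos _
  have hq : Continuous q := by
    rw [funext hqh]
    have := hh.continuous
    fun_prop
  have : IsFiniteMeasure (popMeasure q) := isFiniteMeasure_withDensity_ofReal hqi.2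
  rw [Metric.totallyBounded_iff]
  intro ε hε
  -- The squared error `(ε / 2)²` is shared equally between the ball `K` and its complement.
  set η : ℝ := (ε / 2) ^ 2 / 2 with hη
  have hη0 : 0 < η := by positivity
  obtain ⟨R, hR⟩ := exists_tail_le hh hv hlim hW zero_le_two (one_div_pos.2 hθ).le hη0
  simp only [← hqh] at hR
  set K := Metric.closedBall (0 : E n) R with hKdef
  have hK : MeasurableSet K := Metric.isClosed_closedBall.measurableSet
  obtain ⟨Q, hQ⟩ := (isCompact_closedBall (0 : E n) R).exists_bound_of_continuousOn hq.continuousOn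
  let ζ : ContDiffBump (0 : E n) := ⟨max R 1, max R 1 + 1, by positivity, by linarith⟩
  have hζ1 : ∀ x ∈ K, ζ x = 1 := fun x hx =>
    ζ.one_of_mem_closedBall (Metric.closedBall_subset_closedBall (le_max_left R 1) hx)
  have hζ : ContDiff ℝ 1 ζ := ζ.contDiff
  have hζc : HasCompactSupport ζ := ζ.hasCompactSupport
  obtain ⟨C, hC⟩ := exists_cutoff_bound hq hpos hv.continuous hζ hζc (1 / θ) 2
  -- Since `q ≤ |Q| + 1` on `K`, the Lebesgue error `η / (|Q| + 1)` gives weighted error at most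
  -- `η`.
  obtain ⟨m, p, B, hp, hB⟩ := exists_step_approx (V := E n) R C
    (show 0 < η / (|Q| + 1) by positivity)
  have hcomp : IsCompact (stepLp q hK hp '' Metric.closedBall 0 B) :=
    (isCompact_closedBall 0 B).image (LinearMap.continuous_of_finiteDimensional _)
  obtain ⟨t, ht, hcover⟩ := Metric.totallyBounded_iff.1 hcomp.totallyBounded (ε / 2) (half_pos hε)
  refine ⟨t, ht, fun φ hφ => ?_⟩
  obtain ⟨g, hloc, hφi, hgi, hφD, hgG⟩ :=
    exists_localSobolev hq hpos hv.continuous hS hθ hφ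
  obtain ⟨hC1, hC2⟩ := hC φ g hloc hφi hgi hφD hgG
  obtain ⟨c, hcB, hc⟩ := hB (fun x => ζ x * φ x) (hζ.continuous.measurable.mul hloc.measurable)
    (hloc.memLp_mul hζ.continuous hζc) hC1 hC2
  have hB0 : 0 ≤ B := (abs_nonneg _).trans (hcB (p 0))
  have hmem : stepLp q hK hp c ∈ stepLp q hK hp '' Metric.closedBall 0 B :=
    ⟨c, by rw [mem_closedBall_zero_iff, pi_norm_le_iff_of_nonneg hB0]; exact hcB, rfl⟩
  have hdist : dist φ (stepLp q hK hp c) ≤ ε / 2 := by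
    set F : E n → ℝ := fun x => φ x - K.indicator (fun _ => (1 : ℝ)) x * c (p x) with hF
    have hFae : (φ - stepLp q hK hp c : L2 q) =ᵐ[popMeasure q] F := by
      filter_upwards [Lp.coeFn_sub φ (stepLp q hK hp c), coeFn_stepLp q hK hp c] with x h1 h2
      rw [h1, Pi.sub_apply, h2]
    have hFi : Integrable fun x => F x ^ 2 * q x := by
      refine (integrable_popMeasure_iff hq hpos _).1 ?_
      exact ((memLp_congr_ae hFae).1 (Lp.memLp _)).integrable_sq
    rw [dist_eq_norm]
    refine abs_le_of_sq_le_sq' ?_ (half_pos hε).le |>.2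
    rw [norm_sq_eq_integral hq hpos hFae, ← integral_add_compl hK hFi]
    have h1 : ∫ x in Kᶜ, F x ^ 2 * q x ≤ η := by
      refine le_of_eq_of_le (setIntegral_congr_fun hK.compl fun x hx => ?_)
        (hR φ g hloc hφi hgi hφD hgG)
      simp [hF, Set.indicator_of_notMem hx]
    have hi2 : IntegrableOn (fun x => (ζ x * φ x - c (p x)) ^ 2) K := by
      refine MemLp.integrable_sq (MemLp.sub ((hloc.memLp_mul hζ.continuous hζc).restrict K) ?_)
      have : IsFiniteMeasure (volume.restrict K) :=
        ⟨by simpa using (isCompact_closedBall (0 : E n) R).measure_lt_top⟩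
      exact MemLp.of_bound ((Measurable.of_discrete (f := c)).comp hp).aestronglyMeasurable B
        (ae_of_all _ fun x => hcB _)
    have h2 : ∫ x in K, (ζ x * φ x - c (p x)) ^ 2 ≤ η / (|Q| + 1) := by
      rw [integral_eq_lintegral_of_nonneg_ae (ae_of_all _ fun x => sq_nonneg _)
        hi2.aestronglyMeasurable]
      refine ENNReal.toReal_le_of_le_ofReal (by positivity) ?_
      simpa only [enorm_sq_eq] using hc
    have h3 : ∫ x in K, F x ^ 2 * q x ≤ (|Q| + 1) * ∫ x in K, (ζ x * φ x - c (p x)) ^ 2 := by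
      rw [← integral_const_mul]
      refine setIntegral_mono_on hFi.integrableOn (hi2.const_mul _) hK fun x hx => ?_
      have hqQ : q x ≤ |Q| + 1 := by
        have := (le_abs_self _).trans (hQ x hx)
        linarith [le_abs_self Q]
      simp only [hF, Set.indicator_of_mem hx, hζ1 x hx, one_mul]
      rw [mul_comm]
      exact mul_le_mul_of_nonneg_right hqQ (sq_nonneg _)
    have h4 : (|Q| + 1) * (η / (|Q| + 1)) = η := by
      have : |Q| + 1 ≠ 0 := by positivity
      field_simp
    have h5 := mul_le_mul_of_nonneg_left h2 (show 0 ≤ |Q| + 1 by positivity)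
    linarith
  obtain ⟨y, hy, hby⟩ := Set.mem_iUnion₂.1 (hcover hmem)
  refine Set.mem_iUnion₂.2 ⟨y, hy, ?_⟩
  rw [Metric.mem_ball] at hby ⊢
  linarith [dist_triangle φ (stepLp q hK hp c) y]

end Assembly

end NPC

end

theorem mainTheorem2 (n : ℕ)
    (q h v : NPC.E n → ℝ) (S : NPC.E n → Matrix (Fin n) (Fin n) ℝ) (c : ℝ)
    -- `q` is a positive, continuously differentiable probability density
    (hq_pos : ∀ x, 0 < q x) (hq_diff : ContDiff ℝ 1 q)
    (hq_int : Integrable q) (hq_one : ∫ x, q x = 1)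
    -- `S` is a continuously differentiable, positive definite matrix function
    (hS_diff : ∀ i j, ContDiff ℝ 1 fun x => S x i j) (hS_pos : ∀ x, (S x).PosDef)
    -- `q ^ (1 / 2) = exp (-h)` with `h` of class `C²`
    (hh : ∀ x, Real.sqrt (q x) = Real.exp (-(h x))) (hh_diff : ContDiff ℝ 2 h)
    -- `S ≥ ς² I ≥ c I` with `ς = exp v` of class `C²`
    (hv_diff : ContDiff ℝ 2 v) (hc : 0 < c)
    (hS_lower : ∀ x, Real.exp (v x) ^ 2 • (1 : Matrix (Fin n) (Fin n) ℝ) ≤ S x)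
    (hv_lower : ∀ x, c • (1 : Matrix (Fin n) (Fin n) ℝ) ≤
      Real.exp (v x) ^ 2 • (1 : Matrix (Fin n) (Fin n) ℝ))
    -- `|∇v| / |∇h| → 0` at infinity (the quotient being defined there)
    (ha_ne : ∀ᶠ x in cocompact (NPC.E n), gradient h x ≠ 0)
    (ha : Tendsto (fun x => ‖gradient v x‖ / ‖gradient h x‖) (cocompact (NPC.E n)) (𝓝 0))
    -- `ς² (-tr ∇²h + |∇h|²) → ∞` at infinity
    (hb : Tendsto
      (fun x => Real.exp (v x) ^ 2 * (-(NPC.hessian h x).trace + ‖gradient h x‖ ^ 2))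
      (cocompact (NPC.E n)) atTop) :
    NPC.CompactnessCondition q S := by
  have hqh : ∀ x, q x = Real.exp (-(2 * h x)) := fun x => by
    rw [← Real.sq_sqrt (hq_pos x).le, hh x, ← Real.exp_nat_mul]
    congr 1
    push_cast
    ring
  simp only [NPC.trace_hessian hh_diff] at hb
  -- The divergence in (b) is used here only for its sign: the second factor is eventually
  -- nonnegative because `ς²` is positive.
  have hlim : Tendsto h (cocompact (NPC.E n)) atTop := by
    refine NPC.tendsto_exponent hh_diff (by simpa only [← hqh] using hq_int) ?_
    filter_upwards [hb.eventually (eventually_ge_atTop 0)] with x hx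
    exact nonneg_of_mul_nonneg_right hx (by positivity)
  intro θ hθ
  exact (NPC.totallyBounded_constraintSet hqh hq_int hh_diff hv_diff hS_lower hlim
    (NPC.tendsto_potential ha_ne ha hb) hθ).closure.isCompact_of_isClosed isClosed_closure
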